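/- Let $K$ be a global function field with field of constants $\mathbb F=\mathbb F_q$, let $\infty$ be a place of $K$, and let $A\subset K$ be the ring of elements regular away from $\infty$. Let $K_\infty$ be the completion of $K$ at $\infty$ and $C_\infty$ the completed algebraic closure of $K_\infty$. Fix $r\ge 1$. An $A$-lattice in $K^r$ is a finitely generated $A$-submodule of $K^r$ that spans $K^r$ over $K$. Let $\Psi$ be the set of $\boldsymbol\omega=(\omega_1,\dots,\omega_r)\in C_\infty^r$ with $K_\infty$-linearly independent entries. For a lattice $Y$ and $\boldsymbol\omega\in\Psi$ put $Y_{\boldsymbol\omega}=\{\sum_k y_k\omega_k : y\in Y\}\subset C_\infty$, and for $\Lambda=Y_{\boldsymbol\omega}$ let $e^\Lambda(z)=z\prod_{0\ne\lambda\in\Lambda}(1-z/\lambda)$. For lattices $Y\subseteq Y'$ in $K^r$ let $\Delta^{Y'|Y}(\boldsymbol\omega)$ be the leading coefficient of the $\mathbb F$-linear polynomial $\varphi\in C_\infty[X]$ (only exponents $1,q,q^2,\dots$ occur) of degree $[Y':Y]$ and with linear coefficient $1$ such that $e^{Y'_{\boldsymbol\omega}}=\varphi\circ e^{Y_{\boldsymbol\omega}}$.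 Let $Y\subseteq Y'$ be lattices in $K^r$ and let $\mathfrak p$ be a nonzero prime ideal of $A$, of degree $d=\dim_{\mathbb F}A/\mathfrak p$, that does not divide the Euler–Poincaré characteristic $\chi(Y'/Y)=\prod_{\mathfrak q}\mathfrak q^{\operatorname{length}((Y'/Y)_{\mathfrak q})}$ ($\mathfrak q$ running over the maximal ideals of $A$). For $0\le i<r$ let $\mathcal L(Y,\mathfrak p,i)$ be the set of lattices $Z$ with $\mathfrak pY\subseteq Z\subseteq Y$ and $\dim_{A/\mathfrak p}(Z/\mathfrak pY)=i$, let $c=c_i^{(r)}(\mathfrak p)$ be the number of $i$-dimensional subspaces of $(A/\mathfrak p)^r$, and let $$T^*_{\mathfrak p,i}(\Delta^{Y'|Y})=\prod_{Z\in\mathcal L(Y,\mathfrak p,i)}\Delta^{Z'|Z},\qquad Z'=Z+\mathfrak pY'.$$ **Theorem.** The number $$e=c\,q^{di}\,\frac{q^{d(r-i)}-1}{q^{dr}-1}$$ is a non-negative integer, $\Delta^{Y'|Y}$ has no zeros on $\Psi$, and as functions on $\Psi$ $$T^*_{\mathfrak p,i}(\Delta^{Y'|Y})=\left(\frac{\Delta^{\mathfrak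 pY'|\mathfrak pY}}{\Delta^{Y'|Y}}\right)^{e}(\Delta^{Y'|Y})^{c}.$$ If moreover $\mathfrak p=(n)$ is principal, then $$T^*_{\mathfrak p,i}(\Delta^{Y'|Y})=n^{(1-[Y':Y])e}\,(\Delta^{Y'|Y})^{c}.$$ -/

import Mathlib

open Polynomial
open scoped NNReal

noncomputable section

namespace Drinfeld

/-! ### The global function field, the place at infinity, and the coefficient ring -/

/-- `K` is a global function field with (exact) field of constants `F` (when `F` is finite):
`K` is a finite extension of `F(t)` for some `t` transcendental over `F`, and every element of `K`
that is algebraic over `F` lies in `F`. -/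
class IsGlobalFunctionField (F K : Type*) [Field F] [Field K] [Algebra F K] : Prop where
  exists_finite : ∃ t : K, Transcendental F t ∧
    FiniteDimensional (IntermediateField.adjoin F {t}) K
  mem_constants : ∀ x : K, IsAlgebraic F x → x ∈ Set.range (algebraMap F K)

section CoefficientRing

variable (F : Type*) {K : Type*} [Field F] [Finite F] [Field K] [Algebra F K]

/-- Every valuation ring of `K` contains the finite field `F`. -/
theorem algebraMap_mem_valuationSubring (w : ValuationSubring K) (c : F) :
    algebraMap F K c ∈ w := by
  have := Fintype.ofFinite F
  by_cases hc : c = 0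
  · simp [hc, w.zero_mem]
  · have hpow : (algebraMap F K c) ^ (Fintype.card F - 1) = 1 := by
      rw [← map_pow, FiniteField.pow_card_sub_one_eq_one c hc, map_one]
    have hcard : Fintype.card F - 1 ≠ 0 := by
      have := Fintype.one_lt_card (α := F)
      omega
    rw [← w.valuation_le_one_iff]
    have h : (w.valuation (algebraMap F K c)) ^ (Fintype.card F - 1) = 1 := by
      rw [← map_pow, hpow, map_one]
    exact (pow_le_one_iff_of_nonneg zero_le hcard).mp h.le

/-- The Drinfeld coefficient ring `A` of elements of `K` that are regular away from the place `v`.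
The places of `K` are its nontrivial valuation rings `w ≠ ⊤`, and `x` is regular at `w` if `x`
belongs to `w`. -/
def coeffRing (v : ValuationSubring K) : Subalgebra F K where
  carrier := {x | ∀ w : ValuationSubring K, w ≠ ⊤ → w ≠ v → x ∈ w}
  mul_mem' hx hy w hw hv := w.mul_mem _ _ (hx w hw hv) (hy w hw hv)
  add_mem' hx hy w hw hv := w.add_mem _ _ (hx w hw hv) (hy w hw hv)
  algebraMap_mem' c w _ _ := algebraMap_mem_valuationSubring F w c

end CoefficientRing

/-! ### The completion at infinity and its completed algebraic closure -/

section Completion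

variable {K : Type*} [Field K] (v : ValuationSubring K) [IsDiscreteValuationRing v]

/-- The completion `K_∞` of `K` at the place `v`. -/
abbrev KInf := (IsDiscreteValuationRing.maximalIdeal v).adicCompletion K

/-- The number `q_∞ ≥ 2` of elements of the residue field of `v`.
(The maximum with `2` only serves to make the bound `1 < q_∞` evident.) -/
def qInf {K : Type*} [Field K] (v : ValuationSubring K) : ℝ≥0 := max (Nat.card (IsLocalRing.ResidueField v)) 2

theorem one_lt_qInf {K : Type*} [Field K] (v : ValuationSubring K) : 1 < qInf v := lt_of_lt_of_le one_lt_two (le_max_right _ _)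

instance isRankOneDiscreteKInf :
    (Valued.v : Valuation (KInf v) (WithZero (Multiplicative ℤ))).IsRankOneDiscrete where
  exists_generator_lt_one' := by
    have h := Valuation.IsRankOneDiscrete.mk'
      ((IsDiscreteValuationRing.maximalIdeal v).valuation K)
    exact ⟨h.generator, by
      rw [h.generator_zpowers_eq_valueGroup,
        IsDedekindDomain.HeightOneSpectrum.adicCompletion_valueGroup_eq], h.generator_lt_one⟩

/-- The absolute value on `K_∞` is normalized so that a uniformizer has absolute value
`1 / q_∞`. -/
instance rankOneKInf :
    (Valued.v : Valuation (KInf v) (WithZero (Multiplicative ℤ))).RankOne :=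
  Valuation.IsRankOneDiscrete.rankOne _ (one_lt_qInf v)

instance nontriviallyNormedFieldKInf : NontriviallyNormedField (KInf v) :=
  Valued.toNontriviallyNormedField (KInf v) (WithZero (Multiplicative ℤ))

instance isUltrametricDistKInf : IsUltrametricDist (KInf v) :=
  inferInstance

/-- The algebraic closure of `K_∞`, with the unique extension of the absolute value. -/
instance normedFieldAlgClosure : NormedField (AlgebraicClosure (KInf v)) :=
  spectralNorm.normedField (KInf v) (AlgebraicClosure (KInf v))

instance normedAlgebraAlgClosure : NormedAlgebra (KInf v) (AlgebraicClosure (KInf v)) :=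
  spectralNorm.normedAlgebra (KInf v) (AlgebraicClosure (KInf v))

/-- The completed algebraic closure `C_∞` of `K_∞`. -/
abbrev CInf := UniformSpace.Completion (AlgebraicClosure (KInf v))

end Completion

/-! ### Exponential functions, division functions and discriminants of lattice pairs -/

section Exponential

variable (F : Type*) {K : Type*} [Field F] [Finite F] [Field K] [Algebra F K]
  (v : ValuationSubring K) [IsDiscreteValuationRing v] {r : ℕ}

/-- The Drinfeld space `Ψ^r` of all `ω ∈ C_∞^r` with `K_∞`-linearly independent entries. -/
def Psi (r : ℕ) : Set (Fin r → CInf v) := {ω | LinearIndependent (KInf v) ω}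

variable {v}

/-- The map `i_ω : K^r → C_∞`, `x ↦ x ω = ∑ x_i ω_i`. -/
def iOmega (ω : Fin r → CInf v) : (Fin r → K) →+ CInf v where
  toFun x := ∑ i, algebraMap K (KInf v) (x i) • ω i
  map_zero' := by simp
  map_add' x y := by simp [map_add, add_smul, Finset.sum_add_distrib]

/-- The exponential function `e^Λ(z) = z ∏' (1 - z / λ)`, the product being over `0 ≠ λ ∈ Λ`. -/
def expLattice (Λ : AddSubgroup (CInf v)) (z : CInf v) : CInf v :=
  z * ∏' l : {l : CInf v // l ∈ Λ ∧ l ≠ 0}, (1 - z / (l : CInf v))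

/-- For `Λ ⊆ Λ'`, the polynomial `φ` is the normalized isogeny of the pair: it is `F`-linear, i.e.
only the exponents `1, q, q², …` occur, its linear coefficient is `1`, its degree is `[Λ' : Λ]`, and
`e^Λ' = φ ∘ e^Λ`. -/
structure IsNormalizedIsogeny (Λ' Λ : AddSubgroup (CInf v)) (φ : (CInf v)[X]) : Prop where
  exponents : ∀ k ∈ φ.support, ∃ j : ℕ, k = Nat.card F ^ j
  linear_coeff : φ.coeff 1 = 1
  natDegree_eq : φ.natDegree = Λ.relIndex Λ'
  exp_eq : ∀ z, expLattice Λ' z = φ.eval (expLattice Λ z)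

open Classical in
/-- The discriminant `Δ(Λ'|Λ)`: the leading coefficient of the normalized isogeny of `Λ'|Λ`
(and `0` if there is none). -/
def latticeDisc (Λ' Λ : AddSubgroup (CInf v)) : CInf v :=
  if h : ∃ φ, IsNormalizedIsogeny F Λ' Λ φ then h.choose.leadingCoeff else 0

variable {F}

/-- The lattice `Y_ω = i_ω(Y)` in `C_∞`. -/
def latticeAt (Y : Submodule (coeffRing F v) (Fin r → K)) (ω : Fin r → CInf v) :
    AddSubgroup (CInf v) :=
  Y.toAddSubgroup.map (iOmega ω)

/-- The discriminant function `Δ^{Y'|Y}(ω) = Δ(Y'_ω | Y_ω)`. -/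
def disc (Y' Y : Submodule (coeffRing F v) (Fin r → K)) (ω : Fin r → CInf v) : CInf v :=
  latticeDisc F (latticeAt Y' ω) (latticeAt Y ω)

end Exponential

/-! ### Euler–Poincaré characteristic, lattices of given type, multiplicative Hecke operators -/

section Hecke

/-- The Euler–Poincaré characteristic of a finite module `M` over a Dedekind ring `R`: the ideal
`∏ P ^ ℓ(M_P)`, over all maximal ideals `P`, where `ℓ(M_P)` is the length of the localization. -/
def eulerPoincare (R M : Type*) [CommRing R] [AddCommGroup M] [Module R M] : Ideal R :=
  ∏ᶠ P : MaximalSpectrum R, P.asIdeal ^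
    (Module.length (Localization.AtPrime P.asIdeal)
      (LocalizedModule P.asIdeal.primeCompl M)).toNat

/-- The number of `i`-dimensional subspaces of the `r`-dimensional space over `R / p`. -/
def grassmannCard {R : Type*} [CommRing R] (p : Ideal R) (r i : ℕ) : ℕ :=
  Nat.card {W : Submodule (R ⧸ p) (Fin r → R ⧸ p) // Module.finrank (R ⧸ p) W = i}

section Quotient

variable {R V : Type*} [CommRing R] [AddCommGroup V] [Module R V]

/-- For `Z ⊆ Y` the module `Z / (p Y ∩ Z)` (which is `Z / p Y` if `p Y ⊆ Z`) is killed by `p`. -/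
theorem isTorsionBySet_quotient (p : Ideal R) {Y Z : Submodule R V} (h : Z ≤ Y) :
    Module.IsTorsionBySet R (Z ⧸ (p • Y).submoduleOf Z) p := by
  rintro x ⟨a, ha⟩
  obtain ⟨z, rfl⟩ := Submodule.Quotient.mk_surjective _ x
  rw [← Submodule.Quotient.mk_smul, Submodule.Quotient.mk_eq_zero]
  exact Submodule.smul_mem_smul ha (h z.2)

/-- The dimension over `R / p` of `Z / p Y`, where `p Y ⊆ Z ⊆ Y`. -/
def quotientDim (p : Ideal R) {Y Z : Submodule R V} (h : Z ≤ Y) : ℕ :=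
  letI : Module (R ⧸ p) (Z ⧸ (p • Y).submoduleOf Z) := (isTorsionBySet_quotient p h).module
  Module.finrank (R ⧸ p) (Z ⧸ (p • Y).submoduleOf Z)

end Quotient

variable {F K : Type*} [Field F] [Finite F] [Field K] [Algebra F K]
  {v : ValuationSubring K} {r : ℕ}

/-- The set `L(Y, p, i)` of lattices `Z` with `p Y ⊆ Z ⊆ Y` that have type `i` for `(Y, p)`,
i.e. `dim (Z / p Y) = i` over `A / p`. -/
def latticesOfType (Y : Submodule (coeffRing F v) (Fin r → K)) (p : Ideal (coeffRing F v))
    (i : ℕ) : Set (Submodule (coeffRing F v) (Fin r → K)) :=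
  {Z | Z.IsLattice K ∧ p • Y ≤ Z ∧ ∃ h : Z ≤ Y, quotientDim p h = i}

/-- The multiplicative Hecke operator of type `i` at `p`, applied to `Δ^{Y'|Y}`: the product of the
`Δ^{Z'|Z}` over all `Z` of type `i` for `(Y, p)`, where `Z' = Z + p Y'` is the lattice of type `i`
for `(Y', p)` that corresponds to `Z`. -/
def heckeDisc [IsDiscreteValuationRing v] (p : Ideal (coeffRing F v)) (i : ℕ)
    (Y' Y : Submodule (coeffRing F v) (Fin r → K)) (ω : Fin r → CInf v) : CInf v :=
  ∏ᶠ Z ∈ latticesOfType Y p i, disc (Z ⊔ p • Y') Z ω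

end Hecke

end Drinfeld

end

noncomputable section

namespace Drinfeld

open Filter Topology TensorProduct

/-! ### Infinite products over an ultrametric field -/

section InfiniteProducts

variable {C : Type*} [NormedField C] [IsUltrametricDist C] {ι : Type*}

/-! Discriminants are turned into finite products of values of exponential functions, and the
identity then follows by counting factors.

If `T` represents the nonzero classes of `Λ'` modulo `Λ`, then the normalized isogeny has its
nonzero roots at the numbers `e^Λ(t)`, so `Δ(Λ'|Λ) = ∏ t ∈ T, e^Λ(t)⁻¹` (`latticeDisc_eq`,
`disc_eq`). Since `p` does not divide `χ(Y'/Y)`, some `s ∉ p` kills `Y'/Y`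
(`exists_notMem_smul_eq_zero`). Hence `Y + pY' = Y'` and `Y ∩ pY' = pY`, and a single `T`
representing the nonzero classes of `pY'` modulo `pY` also serves every pair `Z ⊆ Z'`, including `Y
⊆ Y'` (`IsTransversal.sup`).

It remains to compare exponentials at each `t ∈ T`. The lattices `Z` correspond to the `c` subspaces
of dimension `i` in `Y/pY`. Every vector of `Y` outside `pY` lies in the same number `m` of them,
and double counting gives `m(Q^r - 1) = c(Q^i - 1)` with `Q = q^d` (`incidence_mul`). Comparing
linear factors yields `∏_Z e^Z · (e^{pY})^m = (e^{pY})^c · (e^Y)^m` (`prod_expSet_mul`). With `e = c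
- m` this gives `T^* Δ = (Δ^{pY'|pY})^e (Δ^{Y'|Y})^m` (`heckeDisc_eq`), which is the theorem. For `p
= (n)`, the homogeneity `e^{nΛ}(nz) = n e^Λ(z)` evaluates the remaining quotient
(`disc_span_singleton_smul`).

The rest is foundation: convergence and `F`-linearity of `e^Λ`, the Dedekind property and finite
quotients of `A`, and discreteness of lattices in `C_∞`. -/

theorem norm_prod_one_add_sub_one_le {f : ι → C} {s : Finset ι} {ε : ℝ} (h0 : 0 ≤ ε) (h1 : ε ≤ 1)
    (hf : ∀ i ∈ s, ‖f i‖ ≤ ε) : ‖∏ i ∈ s, (1 + f i) - 1‖ ≤ ε := by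
  classical
  induction s using Finset.induction_on with
  | empty => simpa using h0
  | insert a s ha ih =>
    have ih' := ih fun i hi ↦ hf i (Finset.mem_insert_of_mem hi)
    rw [Finset.prod_insert ha]
    set P := ∏ i ∈ s, (1 + f i)
    have hP : ‖P‖ ≤ 1 := by
      have := IsUltrametricDist.norm_add_le_max (P - 1) 1
      rw [sub_add_cancel, norm_one] at this
      exact this.trans (max_le (ih'.trans h1) le_rfl)
    have e : (1 + f a) * P - 1 = (P - 1) + f a * P := by ring
    rw [e]
    refine (IsUltrametricDist.norm_add_le_max _ _).trans (max_le ih' ?_)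
    rw [norm_mul]
    exact (mul_le_of_le_one_right (norm_nonneg _) hP).trans (hf a (Finset.mem_insert_self _ _))

theorem norm_prod_one_add_eq_one {f : ι → C} {s : Finset ι} (hf : ∀ i ∈ s, ‖f i‖ < 1) :
    ‖∏ i ∈ s, (1 + f i)‖ = 1 := by
  rw [norm_prod]
  refine Finset.prod_eq_one fun i hi ↦ ?_
  have h := hf i hi
  rw [IsUltrametricDist.norm_add_eq_max_of_norm_ne_norm (by rw [norm_one]; exact h.ne'), norm_one,
    max_eq_left h.le]

omit [IsUltrametricDist C] in
theorem finite_setOf_le_norm {f : ι → C} (hf : Tendsto f cofinite (𝓝 0)) {ε : ℝ} (hε : 0 < ε) :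
    {i | ε ≤ ‖f i‖}.Finite := by
  have h := hf (Metric.ball_mem_nhds 0 hε)
  rw [mem_map, mem_cofinite] at h
  refine h.subset fun i hi ↦ ?_
  simpa using hi

/-- All but finitely many factors have norm exactly `1`, so the norms of the partial products
stabilize. This gives both the Cauchy property and the nonvanishing of the limit. -/
theorem exists_norm_prod_eq {f : ι → C} (hf : Tendsto f cofinite (𝓝 0)) :
    ∃ s₀ : Finset ι, ∀ s, s₀ ⊆ s → ‖∏ i ∈ s, (1 + f i)‖ = ‖∏ i ∈ s₀, (1 + f i)‖ := by
  classical
  have h0 := finite_setOf_le_norm hf one_pos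
  refine ⟨h0.toFinset, fun s hs ↦ ?_⟩
  rw [← Finset.prod_sdiff hs, norm_mul, norm_prod_one_add_eq_one, one_mul]
  intro i hi
  simpa using (Finset.mem_sdiff.mp hi).2

theorem multipliable_one_add_of_tendsto_zero [CompleteSpace C] {f : ι → C}
    (hf : Tendsto f cofinite (𝓝 0)) : Multipliable fun i ↦ 1 + f i := by
  classical
  obtain ⟨s₀, hs₀⟩ := exists_norm_prod_eq hf
  have hc : CauchySeq fun s : Finset ι ↦ ∏ i ∈ s, (1 + f i) := by
    rw [Metric.cauchySeq_iff']
    intro ε hε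
    set M := ‖∏ i ∈ s₀, (1 + f i)‖
    have hM : 0 ≤ M := norm_nonneg _
    -- The bound `1` is needed for the ultrametric product estimate; the other bound gives `δ * M <
    -- ε`, with `M + 1` covering `M = 0`.
    set δ := min 1 (ε / (2 * (M + 1)))
    have hδ : 0 < δ := by positivity
    have hfin := finite_setOf_le_norm hf hδ
    refine ⟨s₀ ∪ hfin.toFinset, fun s hs ↦ ?_⟩
    rw [dist_eq_norm, ← Finset.prod_sdiff hs]
    set P := ∏ i ∈ s₀ ∪ hfin.toFinset, (1 + f i)
    have hP : ‖P‖ = M := hs₀ _ Finset.subset_union_left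
    have h1 : ‖∏ i ∈ s \ (s₀ ∪ hfin.toFinset), (1 + f i) - 1‖ ≤ δ := by
      refine norm_prod_one_add_sub_one_le hδ.le (min_le_left _ _) fun i hi ↦ ?_
      simp only [Finset.mem_sdiff, Finset.mem_union, Set.Finite.mem_toFinset, Set.mem_ofPred_eq,
        not_or, not_le] at hi
      exact hi.2.2.le
    rw [← sub_one_mul, norm_mul, hP]
    calc _ ≤ δ * M := by gcongr
      _ ≤ ε / (2 * (M + 1)) * M := by gcongr; exact min_le_right _ _
      _ < ε := by
        rw [div_mul_eq_mul_div, div_lt_iff₀ (by positivity)]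
        nlinarith
  obtain ⟨a, ha⟩ := cauchySeq_tendsto_of_complete hc
  exact ⟨a, by simpa [HasProd] using ha⟩

theorem tprod_one_add_ne_zero [CompleteSpace C] {f : ι → C}
    (hf : Tendsto f cofinite (𝓝 0)) (h0 : ∀ i, 1 + f i ≠ 0) : ∏' i, (1 + f i) ≠ 0 := by
  obtain ⟨s₀, hs₀⟩ := exists_norm_prod_eq hf
  have h := (multipliable_one_add_of_tendsto_zero hf).hasProd
  have h' : Tendsto (fun s : Finset ι ↦ ‖∏ i ∈ s, (1 + f i)‖) atTop (𝓝 ‖∏' i, (1 + f i)‖) := by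
    refine Tendsto.norm ?_
    simpa [HasProd] using h
  have h2 : Tendsto (fun s : Finset ι ↦ ‖∏ i ∈ s, (1 + f i)‖) atTop
      (𝓝 ‖∏ i ∈ s₀, (1 + f i)‖) :=
    tendsto_const_nhds.congr' <| (eventually_ge_atTop s₀).mono fun s hs ↦ (hs₀ s hs).symm
  rw [← norm_ne_zero_iff, tendsto_nhds_unique h' h2, norm_ne_zero_iff]
  exact Finset.prod_ne_zero_iff.mpr fun i _ ↦ h0 i

end InfiniteProducts

/-! ### Products of the factors `1 - z / l` over sets with finite balls -/

section FactorFunctions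

variable {C : Type*} [NormedField C]

/-- A subset of a normed field has finite balls if it has finitely many elements of bounded
norm. -/
def FiniteBalls (S : Set C) : Prop := ∀ R : ℝ, (S ∩ {x | ‖x‖ ≤ R}).Finite

theorem FiniteBalls.mono {S T : Set C} (hT : FiniteBalls T) (h : S ⊆ T) : FiniteBalls S :=
  fun R ↦ (hT R).subset (Set.inter_subset_inter_left _ h)

/-- The function with value `1 - z / l` at `l ∈ S` and `1` outside `S`. -/
def factor (S : Set C) (z : C) : C → C := S.mulIndicator fun l ↦ 1 - z / l

/-- The product of the `1 - z / l`, where `l` runs over `S`. -/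
def prodOver (S : Set C) (z : C) : C := ∏' l, factor S z l

theorem factor_of_mem {S : Set C} {z l : C} (h : l ∈ S) : factor S z l = 1 - z / l :=
  Set.mulIndicator_of_mem h _

theorem factor_of_notMem {S : Set C} {z l : C} (h : l ∉ S) : factor S z l = 1 :=
  Set.mulIndicator_of_notMem h _

theorem factor_eq_one_add (S : Set C) (z : C) :
    factor S z = fun l ↦ 1 + S.indicator (fun l ↦ -(z / l)) l := by
  classical
  ext l
  by_cases h : l ∈ S <;> simp [factor, h, sub_eq_add_neg]

theorem tendsto_indicator_div {S : Set C} (hS : FiniteBalls S) (z : C) :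
    Tendsto (S.indicator fun l ↦ -(z / l)) cofinite (𝓝 0) := by
  rw [Metric.tendsto_nhds]
  intro ε hε
  rw [eventually_cofinite]
  refine (hS (‖z‖ / ε)).subset fun l hl ↦ ?_
  simp only [dist_zero_right, not_lt, Set.mem_ofPred_eq] at hl
  have hlS : l ∈ S := by
    by_contra h
    rw [Set.indicator_of_notMem h, norm_zero] at hl
    exact hε.not_ge hl
  refine ⟨hlS, ?_⟩
  rw [Set.indicator_of_mem hlS, norm_neg, norm_div] at hl
  have hl0 : 0 < ‖l‖ := by
    -- The point `l = 0` is harmless: `z / 0 = 0`, so its factor is `1`.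
    rcases (norm_nonneg l).eq_or_lt with h | h
    · rw [← h, div_zero] at hl
      exact absurd hl hε.not_ge
    · exact h
  rw [Set.mem_ofPred_eq, le_div_iff₀ hε, mul_comm]
  rwa [le_div_iff₀ hl0] at hl

variable [IsUltrametricDist C] [CompleteSpace C]

theorem hasProd_factor {S : Set C} (hS : FiniteBalls S) (z : C) :
    HasProd (factor S z) (prodOver S z) := by
  refine Multipliable.hasProd ?_
  rw [factor_eq_one_add]
  exact multipliable_one_add_of_tendsto_zero (tendsto_indicator_div hS z)

theorem prodOver_ne_zero {S : Set C} (hS : FiniteBalls S) (h0 : 0 ∉ S) {z : C} (hz : z ∉ S) :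
    prodOver S z ≠ 0 := by
  have h := tprod_one_add_ne_zero (tendsto_indicator_div hS z)
  rw [prodOver, factor_eq_one_add]
  refine h fun l ↦ ?_
  by_cases hl : l ∈ S
  · rw [Set.indicator_of_mem hl, ← sub_eq_add_neg, sub_ne_zero]
    rintro e
    have : l ≠ 0 := by rintro rfl; exact h0 hl
    rw [eq_div_iff this, one_mul] at e
    exact hz (e ▸ hl)
  · simp [hl]

theorem prodOver_eq_zero {S : Set C} (hS : FiniteBalls S) {z : C} (hz : z ∈ S) (hz0 : z ≠ 0) :
    prodOver S z = 0 := by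
  have h := hasProd_factor hS z
  have h2 : HasProd (factor S z) 0 := hasProd_zero_of_exists_eq_zero
    ⟨z, by rw [factor_of_mem hz, div_self hz0, sub_self]⟩
  exact h.unique h2

end FactorFunctions

/-! ### `F`-linear polynomials -/

section LinearPolynomials

variable (F L : Type*) [Field L]

/-- The `F`-linear polynomials over an extension field `L` of the finite field `F` with `q`
elements, i.e. the linear combinations of `X, X ^ q, X ^ q ^ 2, …`. -/
def linearPolynomials : Submodule L L[X] :=
  Submodule.span L (Set.range fun j : ℕ ↦ (X : L[X]) ^ Nat.card F ^ j)

variable {F L}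

theorem exists_eq_of_mem_support {P : L[X]} (hP : P ∈ linearPolynomials F L) :
    ∀ k ∈ P.support, ∃ j : ℕ, k = Nat.card F ^ j := by
  suffices h : ∀ k, (¬ ∃ j : ℕ, k = Nat.card F ^ j) → P.coeff k = 0 from
    fun k hk ↦ by_contra fun hj ↦ mem_support_iff.mp hk (h k hj)
  intro k hk
  induction hP using Submodule.span_induction with
  | mem x hx =>
    obtain ⟨j, rfl⟩ := hx
    rw [coeff_X_pow, if_neg fun e ↦ hk ⟨j, e⟩]
  | zero => simp
  | add x y _ _ hx hy => rw [coeff_add, hx, hy, add_zero]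
  | smul a x _ hx => rw [coeff_smul, hx, smul_zero]

variable [Field F] [Finite F] [Algebra F L]

theorem pow_card_pow_add (x y : L) (j : ℕ) :
    (x + y) ^ Nat.card F ^ j = x ^ Nat.card F ^ j + y ^ Nat.card F ^ j := by
  have := Fintype.ofFinite F
  induction j with
  | zero => simp
  | succ j ih =>
    have h := map_add (FiniteField.frobeniusAlgHom F L) (x ^ Nat.card F ^ j) (y ^ Nat.card F ^ j)
    simp only [FiniteField.coe_frobeniusAlgHom] at h
    simp only [pow_succ (Nat.card F), pow_mul]
    rw [ih]
    simpa using h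

theorem pow_card_pow_smul (c : F) (x : L) (j : ℕ) :
    (c • x) ^ Nat.card F ^ j = c • x ^ Nat.card F ^ j := by
  have := Fintype.ofFinite F
  rw [_root_.smul_pow, Nat.card_eq_fintype_card, FiniteField.pow_card_pow]

/-- The evaluation of an `F`-linear polynomial is an `F`-linear map. -/
def evalLinear {P : L[X]} (hP : P ∈ linearPolynomials F L) : L →ₗ[F] L where
  toFun x := P.eval x
  map_add' x y := by
    induction hP using Submodule.span_induction with
    | mem P hP =>
      obtain ⟨j, rfl⟩ := hP
      simp [pow_card_pow_add]
    | zero => simp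
    | add P Q _ _ hP hQ => simp only [eval_add, hP, hQ]; ring
    | smul a P _ hP => simp only [eval_smul, hP, smul_add]
  map_smul' c x := by
    rw [RingHom.id_apply]
    induction hP using Submodule.span_induction with
    | mem P hP =>
      obtain ⟨j, rfl⟩ := hP
      simp [pow_card_pow_smul]
    | zero => simp
    | add P Q _ _ hP hQ => simp only [eval_add, hP, hQ, smul_add]
    | smul a P _ hP => rw [eval_smul, eval_smul, hP, smul_comm]

theorem evalLinear_apply {P : L[X]} (hP : P ∈ linearPolynomials F L) (x : L) :
    evalLinear hP x = P.eval x := rfl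

theorem pow_card_mem_linearPolynomials {P : L[X]} (hP : P ∈ linearPolynomials F L) :
    P ^ Nat.card F ∈ linearPolynomials F L := by
  have := Fintype.ofFinite F
  have e : ∀ Q : L[X], FiniteField.frobeniusAlgHom F L[X] Q = Q ^ Nat.card F := fun Q ↦ by
    rw [FiniteField.coe_frobeniusAlgHom, Nat.card_eq_fintype_card]
  induction hP using Submodule.span_induction with
  | mem x hx =>
    obtain ⟨j, rfl⟩ := hx
    refine Submodule.subset_span ⟨j + 1, ?_⟩
    simp only [pow_succ (Nat.card F), pow_mul]
  | zero => rw [zero_pow Nat.card_pos.ne']; exact zero_mem _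
  | add x y _ _ hx hy => rw [← e, map_add, e, e]; exact add_mem hx hy
  | smul a x _ hx => rw [_root_.smul_pow]; exact Submodule.smul_mem _ _ hx

/-- The `q`-th powers in an `F`-algebra agree with the identity exactly on `F`. -/
theorem exists_algebraMap_eq {x : L} (hx : x ^ Nat.card F = x) : ∃ c : F, algebraMap F L c = x := by
  have := Fintype.ofFinite F
  classical
  by_contra! h
  have hq : 1 < Nat.card F := Finite.one_lt_card
  have hinj := (algebraMap F L).injective
  have hx' : x ∉ Finset.univ.map ⟨_, hinj⟩ := by simpa using h
  have hc := card_le_degree_of_subset_roots (p := (X ^ Nat.card F - X : L[X]))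
    (Z := insert x (Finset.univ.map ⟨_, hinj⟩)) fun y hy ↦ by
      rw [mem_roots (FiniteField.X_pow_card_sub_X_ne_zero L hq), IsRoot, eval_sub, eval_pow, eval_X,
        sub_eq_zero]
      rcases Finset.mem_insert.mp hy with rfl | hy
      · exact hx
      · obtain ⟨c, -, rfl⟩ := Finset.mem_map.mp hy
        simp only [Function.Embedding.coeFn_mk]
        rw [← map_pow, Nat.card_eq_fintype_card, FiniteField.pow_card]
  rw [Finset.card_insert_of_notMem hx', Finset.card_map, Finset.card_univ,
    FiniteField.X_pow_card_sub_X_natDegree_eq L hq, Nat.card_eq_fintype_card] at hc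
  omega

/-- Induction on generators: if `P` belongs to `W` and `b = P(u) ≠ 0`, then `P^q - b^(q-1) P`
belongs to `W + F u`. Its zeros are the `x` with `(P(x)/b)^q = P(x)/b`, that is, `P(x) ∈ F b = P(F
u)`. -/
theorem exists_monic_mem_linearPolynomials (s : Finset L) :
    ∃ P ∈ linearPolynomials F L, P.Monic ∧
      P.natDegree = Nat.card (Submodule.span F (s : Set L)) ∧
      ∀ x, P.eval x = 0 ↔ x ∈ Submodule.span F (s : Set L) := by
  classical
  induction s using Finset.induction_on with
  | empty =>
    refine ⟨X, Submodule.subset_span ⟨0, by simp⟩, monic_X, ?_, ?_⟩ <;> simp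
  | insert u s hu ih =>
    obtain ⟨P, hP, hm, hd, h0⟩ := ih
    set W := Submodule.span F (s : Set L) with hW
    rw [Finset.coe_insert, Submodule.span_insert, ← hW]
    by_cases huW : u ∈ W
    · have : Submodule.span F {u} ⊔ W = W :=
        sup_eq_right.mpr (by simpa using huW)
      rw [this]
      exact ⟨P, hP, hm, hd, h0⟩
    have hb : P.eval u ≠ 0 := fun h ↦ huW ((h0 u).mp h)
    set b := P.eval u
    have hq : 1 < Nat.card F := Finite.one_lt_card
    have hfin : Module.Finite F W := Module.Finite.span_of_finite F s.finite_toSet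
    have hcard : Nat.card ↥(Submodule.span F {u} ⊔ W) = Nat.card F * Nat.card W := by
      have h1 := Submodule.finrank_sup_add_finrank_inf_eq (Submodule.span F {u}) W
      have h2 : Submodule.span F {u} ⊓ W = ⊥ := by
        rw [← disjoint_iff]
        exact (Submodule.disjoint_span_singleton_of_notMem huW).symm
      have hu0 : u ≠ 0 := by rintro rfl; exact huW (zero_mem _)
      rw [h2, finrank_bot, finrank_span_singleton hu0, add_zero] at h1
      rw [Module.natCard_eq_pow_finrank (K := F), h1, Module.natCard_eq_pow_finrank (K := F) (V := W),
        pow_add, pow_one]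
    have hdeg0 : 0 < P.natDegree := by
      rw [hd]
      have : Finite W := Module.finite_of_finite F
      exact Nat.card_pos
    have hlt : (C (b ^ (Nat.card F - 1)) * P).natDegree < (P ^ Nat.card F).natDegree := by
      refine (natDegree_C_mul_le _ _).trans_lt ?_
      rw [natDegree_pow]
      exact (Nat.lt_mul_iff_one_lt_left hdeg0).mpr hq
    refine ⟨P ^ Nat.card F - C (b ^ (Nat.card F - 1)) * P, ?_, ?_, ?_, fun x ↦ ?_⟩
    · refine sub_mem (pow_card_mem_linearPolynomials hP) ?_
      rw [← smul_eq_C_mul]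
      exact Submodule.smul_mem _ _ hP
    · exact (hm.pow _).sub_of_left (degree_lt_degree hlt)
    · rw [natDegree_sub_eq_left_of_natDegree_lt hlt, natDegree_pow, hd, hcard]
    · rw [sup_comm, Submodule.mem_sup]
      simp only [eval_sub, eval_pow, eval_mul, eval_C]
      have hqs : Nat.card F = (Nat.card F - 1) + 1 := by omega
      constructor
      · intro h
        have h' : (P.eval x / b) ^ Nat.card F = P.eval x / b := by
          rw [sub_eq_zero] at h
          rw [div_pow, h, div_eq_div_iff (pow_ne_zero _ hb) hb]
          conv_rhs => rw [hqs, pow_succ]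
          ring
        obtain ⟨c, hc⟩ := exists_algebraMap_eq h'
        refine ⟨x - c • u, ?_, c • u, Submodule.smul_mem _ _ (Submodule.mem_span_singleton_self u),
          by simp⟩
        rw [← h0, ← evalLinear_apply hP, map_sub, map_smul, evalLinear_apply, evalLinear_apply,
          Algebra.smul_def, hc, div_mul_cancel₀ _ hb, sub_self]
      · rintro ⟨w, hw, y, hy, rfl⟩
        obtain ⟨c, rfl⟩ := Submodule.mem_span_singleton.mp hy
        have : P.eval (w + c • u) = c • b := by
          rw [← evalLinear_apply hP, map_add, map_smul, evalLinear_apply, evalLinear_apply,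
            (h0 w).mpr hw, zero_add]
        have hc : c ^ Nat.card F = c := by
          have := Fintype.ofFinite F
          rw [Nat.card_eq_fintype_card, FiniteField.pow_card]
        rw [this, _root_.smul_pow, hc, mul_smul_comm, ← pow_succ, ← hqs, sub_self]

/-- The polynomial with simple zeros exactly at a finite `F`-subspace is `F`-linear. -/
theorem prod_X_sub_C_mem_linearPolynomials {W : Submodule F L} {T : Finset L}
    (hT : (T : Set L) = W) : ∏ w ∈ T, (X - C w) ∈ linearPolynomials F L := by
  obtain ⟨P, hP, hm, hd, h0⟩ := exists_monic_mem_linearPolynomials (F := F) T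
  rw [hT, Submodule.span_eq] at hd h0
  have hmT : (∏ w ∈ T, (X - C w)).Monic := monic_prod_of_monic _ _ fun w _ ↦ monic_X_sub_C w
  have hcard : Nat.card W = T.card := by
    rw [← Nat.card_eq_finsetCard]
    exact Nat.card_congr (Equiv.setCongr hT).symm
  -- The product divides the `F`-linear polynomial with the same zeros; both are monic of the same
  -- degree, hence equal.
  have hdvd : ∏ w ∈ T, (X - C w) ∣ P := by
    refine Finset.prod_dvd_of_coprime (fun a _ b _ hab ↦ ?_) fun w hw ↦ ?_
    · exact pairwise_coprime_X_sub_C Function.injective_id hab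
    · rw [dvd_iff_isRoot, IsRoot, h0]
      exact hT.subset hw
  have := eq_of_monic_of_dvd_of_natDegree_le hmT hm hdvd (by
    rw [natDegree_prod_of_monic _ _ fun w _ ↦ monic_X_sub_C w, hd, hcard]
    simp)
  rw [← this]
  exact hP

end LinearPolynomials

/-! ### The polynomial with prescribed simple zeros and linear coefficient `1` -/

section NormalizedPolynomial

variable {F L : Type*} [Field F] [Finite F] [Field L] [Algebra F L]

/-- The polynomial `X ∏ (1 - X / w)`, where `w` runs over `S`. -/
def normalizedPoly (S : Finset L) : L[X] := X * ∏ w ∈ S, (1 - C w⁻¹ * X)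

theorem eval_normalizedPoly (S : Finset L) (z : L) :
    (normalizedPoly S).eval z = z * ∏ w ∈ S, (1 - z / w) := by
  simp [normalizedPoly, eval_prod, div_eq_inv_mul]

variable {S : Finset L} (hS : 0 ∉ S)
include hS

theorem normalizedPoly_eq_mul :
    normalizedPoly S = (∏ w ∈ S, -w⁻¹) • ∏ w ∈ Finset.cons 0 S hS, (X - C w) := by
  rw [Finset.prod_cons, normalizedPoly, map_zero, sub_zero, ← mul_smul_comm, smul_eq_C_mul,
    map_prod, ← Finset.prod_mul_distrib]
  congr 1
  refine Finset.prod_congr rfl fun w hw ↦ ?_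
  have hw0 : w ≠ 0 := by rintro rfl; exact hS hw
  rw [mul_sub, ← C_mul, neg_mul, inv_mul_cancel₀ hw0, C_neg, C_neg, C_1]
  ring

theorem natDegree_normalizedPoly : (normalizedPoly S).natDegree = S.card + 1 := by
  have h : ∏ w ∈ S, -w⁻¹ ≠ 0 := Finset.prod_ne_zero_iff.mpr fun w hw ↦
    neg_ne_zero.mpr <| inv_ne_zero <| by rintro rfl; exact hS hw
  rw [normalizedPoly_eq_mul hS, natDegree_smul _ h,
    natDegree_prod_of_monic _ _ fun w _ ↦ monic_X_sub_C w]
  simp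

theorem leadingCoeff_normalizedPoly : (normalizedPoly S).leadingCoeff = ∏ w ∈ S, -w⁻¹ := by
  have h : (∏ w ∈ Finset.cons 0 S hS, (X - C w)).Monic :=
    monic_prod_of_monic _ _ fun w _ ↦ monic_X_sub_C w
  rw [normalizedPoly_eq_mul hS, smul_eq_C_mul, leadingCoeff_mul, leadingCoeff_C, h.leadingCoeff,
    mul_one]

omit hS in
theorem coeff_one_normalizedPoly (S : Finset L) : (normalizedPoly S).coeff 1 = 1 := by
  rw [normalizedPoly, ← zero_add 1, coeff_X_mul, coeff_zero_eq_eval_zero, eval_prod]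
  simp

theorem normalizedPoly_mem_linearPolynomials {W : Submodule F L}
    (hW : insert 0 (S : Set L) = W) : normalizedPoly S ∈ linearPolynomials F L := by
  rw [normalizedPoly_eq_mul hS]
  refine Submodule.smul_mem _ _ (prod_X_sub_C_mem_linearPolynomials (W := W) ?_)
  rw [← hW, Finset.coe_cons]

/-- The substitution `w ↦ -w` permutes `S`, so the signs disappear in every characteristic. -/
theorem prod_neg_inv_eq {W : AddSubgroup L} (hW : insert 0 (S : Set L) = W) :
    ∏ w ∈ S, -w⁻¹ = ∏ w ∈ S, w⁻¹ := by
  have hmem : ∀ w ∈ S, -w ∈ S := fun w hw ↦ by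
    have h1 : w ∈ W := hW.subset (Or.inr hw)
    rcases hW.superset (W.neg_mem h1) with h | h
    · rw [neg_eq_zero] at h
      exact absurd (h ▸ hw) hS
    · exact h
  exact Finset.prod_nbij' (fun w ↦ -w) (fun w ↦ -w) hmem hmem (by simp) (by simp)
    fun w _ ↦ by rw [inv_neg]

end NormalizedPolynomial

/-! ### The exponential function and its `F`-linearity -/

section Exponential

variable {C : Type*} [NormedField C]

/-- The exponential function of a subset `S` of `C`: the product of `z` and the `1 - z / l`, where
`l` runs over the nonzero elements of `S`. -/
def expSet (S : Set C) (z : C) : C := z * prodOver (S \ {0}) z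

variable [IsUltrametricDist C] [CompleteSpace C]

theorem expSet_eq_zero_iff {S : Set C} (hS : FiniteBalls S) (h0 : (0 : C) ∈ S) {z : C} :
    expSet S z = 0 ↔ z ∈ S := by
  have hS' : FiniteBalls (S \ {0}) := hS.mono Set.sdiff_subset
  rw [expSet, mul_eq_zero]
  refine ⟨fun h ↦ ?_, fun h ↦ ?_⟩
  · rcases h with rfl | h
    · exact h0
    · by_contra hz
      exact prodOver_ne_zero hS' (fun h ↦ h.2 rfl) (fun h ↦ hz h.1) h
  · by_cases hz : z = 0
    · exact Or.inl hz
    · exact Or.inr (prodOver_eq_zero hS' ⟨h, hz⟩ hz)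

variable {F : Type*} [Field F] [Finite F] [Algebra F C]

omit [IsUltrametricDist C] [CompleteSpace C] in
theorem norm_algebraMap_le_one (c : F) : ‖algebraMap F C c‖ ≤ 1 := by
  have := Fintype.ofFinite F
  by_cases hc : c = 0
  · simp [hc]
  · have h : (algebraMap F C c) ^ (Fintype.card F - 1) = 1 := by
      rw [← map_pow, FiniteField.pow_card_sub_one_eq_one c hc, map_one]
    have hcard : Fintype.card F - 1 ≠ 0 := by
      have := Fintype.one_lt_card (α := F)
      omega
    have h2 := congrArg norm h
    rw [norm_pow, norm_one] at h2
    exact ((pow_eq_one_iff_of_nonneg (norm_nonneg _) hcard).mp h2).le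

/-- The elements of norm at most `n` of an `F`-subspace. -/
def ballSubmodule (Λ : Submodule F C) (n : ℕ) : Submodule F C where
  carrier := Λ ∩ {x | ‖x‖ ≤ n}
  add_mem' hx hy :=
    ⟨Λ.add_mem hx.1 hy.1, (IsUltrametricDist.norm_add_le_max _ _).trans (max_le hx.2 hy.2)⟩
  zero_mem' := ⟨Λ.zero_mem, by simp⟩
  smul_mem' c x hx := ⟨Λ.smul_mem c hx.1, by
    rw [Set.mem_ofPred_eq, Algebra.smul_def, norm_mul]
    exact (mul_le_of_le_one_left (norm_nonneg _) (norm_algebraMap_le_one c)).trans hx.2⟩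

variable {Λ : Submodule F C}

/-- The part of `Λ` in a ball is a finite `F`-subspace, because the norm is ultrametric and
constants have norm at most `1`. The truncated products are therefore `F`-linear polynomials, and
`F`-linearity passes to the limit. -/
theorem exists_tendsto_expSet (hΛ : FiniteBalls (Λ : Set C)) :
    ∃ P : ℕ → C[X], (∀ n, P n ∈ linearPolynomials F C) ∧
      ∀ z, Tendsto (fun n ↦ (P n).eval z) atTop (𝓝 (expSet (Λ : Set C) z)) := by
  classical
  let S : Set C := (Λ : Set C) \ {0}
  have hfin (n : ℕ) : (S ∩ {x | ‖x‖ ≤ n}).Finite := (hΛ.mono Set.sdiff_subset) n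
  let T (n : ℕ) : Finset C := (hfin n).toFinset
  have hT0 (n : ℕ) : 0 ∉ T n := by simp [T, S]
  refine ⟨fun n ↦ normalizedPoly (T n), fun n ↦ ?_, fun z ↦ ?_⟩
  · refine normalizedPoly_mem_linearPolynomials (hT0 n) (W := ballSubmodule Λ n) ?_
    ext x
    by_cases hx : x = 0
    · simp [hx, zero_mem]
    · simp only [Set.mem_insert_iff, hx, false_or, T, S, Set.Finite.coe_toFinset,
        Set.mem_inter_iff, Set.mem_sdiff, Set.mem_singleton_iff, not_false_eq_true, and_true]
      exact Iff.rfl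
  · simp only [eval_normalizedPoly, expSet]
    refine Tendsto.const_mul _ ?_
    have h := hasProd_factor (hΛ.mono Set.sdiff_subset : FiniteBalls S) z
    rw [factor, ← hasProd_subtype_iff_mulIndicator] at h
    let U (n : ℕ) : Finset S := (T n).subtype (· ∈ S)
    have hU : Tendsto U atTop atTop := by
      refine tendsto_atTop_finset_of_monotone (fun m n hmn x hx ↦ ?_) fun x ↦ ?_
      · simp only [U, Finset.mem_subtype, T, Set.Finite.mem_toFinset, Set.mem_inter_iff,
          Set.mem_ofPred_eq] at hx ⊢
        exact ⟨hx.1, hx.2.trans (by exact_mod_cast hmn)⟩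
      · obtain ⟨n, hn⟩ := exists_nat_ge ‖(x : C)‖
        exact ⟨n, by simp [U, T, hn]⟩
    have h' : Tendsto (fun s : Finset S ↦ ∏ l ∈ s, (1 - z / (l : C))) atTop
      (𝓝 (prodOver S z)) := by simpa [HasProd] using h
    refine (h'.comp hU).congr fun n ↦ ?_
    simp only [Function.comp_apply]
    refine (Finset.prod_subtype_eq_prod_filter (fun l ↦ 1 - z / l)).trans ?_
    refine Finset.prod_congr (Finset.filter_true_of_mem fun x hx ↦ ?_) fun _ _ ↦ rfl
    simp only [T, Set.Finite.mem_toFinset] at hx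
    exact hx.1

/-- The exponential function of an `F`-subspace with finite balls, as an `F`-linear map. -/
def expLinear (hΛ : FiniteBalls (Λ : Set C)) : C →ₗ[F] C where
  toFun := expSet Λ
  map_add' x y := by
    obtain ⟨P, hP, h⟩ := exists_tendsto_expSet hΛ
    refine tendsto_nhds_unique (h (x + y)) (((h x).add (h y)).congr fun n ↦ ?_)
    simp only [← evalLinear_apply (hP n), map_add]
  map_smul' c x := by
    obtain ⟨P, hP, h⟩ := exists_tendsto_expSet hΛ
    refine tendsto_nhds_unique (h (c • x)) ?_
    rw [RingHom.id_apply, Algebra.smul_def c (expSet _ x)]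
    refine ((h x).const_mul (algebraMap F C c)).congr fun n ↦ ?_
    rw [← evalLinear_apply (hP n), ← evalLinear_apply (hP n), ← Algebra.smul_def, map_smul]

theorem expLinear_eq_zero_iff (hΛ : FiniteBalls (Λ : Set C)) {z : C} :
    expLinear hΛ z = 0 ↔ z ∈ Λ :=
  expSet_eq_zero_iff hΛ Λ.zero_mem

theorem expLinear_eq_iff (hΛ : FiniteBalls (Λ : Set C)) {x y : C} :
    expLinear hΛ x = expLinear hΛ y ↔ x - y ∈ Λ := by
  rw [← expLinear_eq_zero_iff hΛ, map_sub, sub_eq_zero]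

end Exponential

/-! ### Representatives of the nonzero classes of a subgroup pair -/

section Transversal

/-- `T` is a system of representatives of the nonzero classes of `Λ'` modulo `Λ`. -/
structure IsTransversal {G : Type*} [AddCommGroup G] (T : Finset G) (Λ' Λ : AddSubgroup G) :
    Prop where
  mem : ∀ t ∈ T, t ∈ Λ'
  notMem : ∀ t ∈ T, t ∉ Λ
  eq_of_sub_mem : ∀ s ∈ T, ∀ t ∈ T, s - t ∈ Λ → s = t
  exists_sub_mem : ∀ x ∈ Λ', x ∉ Λ → ∃ t ∈ T, x - t ∈ Λ

variable {G : Type*} [AddCommGroup G] {T : Finset G} {Λ' Λ : AddSubgroup G}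

theorem IsTransversal.injOn_of_ker_eq {H : Type*} [AddCommGroup H] (hT : IsTransversal T Λ' Λ)
    {f : G →+ H} (hf : f.ker = Λ) : Set.InjOn f T := fun s hs t ht h ↦
  hT.eq_of_sub_mem s hs t ht (by rw [← hf, AddMonoidHom.mem_ker, map_sub, h, sub_self])

theorem IsTransversal.insert_image_eq {H : Type*} [AddCommGroup H] [DecidableEq H]
    (hT : IsTransversal T Λ' Λ) {f : G →+ H} (hf : f.ker = Λ) :
    insert 0 (T.image f : Set H) = Λ'.map f := by
  ext y
  simp only [Finset.coe_image, Set.mem_insert_iff, Set.mem_image, SetLike.mem_coe,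
    AddSubgroup.mem_map]
  constructor
  · rintro (rfl | ⟨t, ht, rfl⟩)
    · exact ⟨0, Λ'.zero_mem, map_zero f⟩
    · exact ⟨t, hT.mem t ht, rfl⟩
  · rintro ⟨x, hx, rfl⟩
    by_cases hxΛ : x ∈ Λ
    · exact Or.inl (by rwa [← hf] at hxΛ)
    · obtain ⟨t, ht, h⟩ := hT.exists_sub_mem x hx hxΛ
      refine Or.inr ⟨t, ht, ?_⟩
      rw [← hf, AddMonoidHom.mem_ker, map_sub, sub_eq_zero] at h
      exact h.symm

theorem IsTransversal.zero_notMem_image {H : Type*} [AddCommGroup H] [DecidableEq H]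
    (hT : IsTransversal T Λ' Λ) {f : G →+ H} (hf : f.ker = Λ) : 0 ∉ T.image f := by
  intro h
  obtain ⟨t, ht, h⟩ := Finset.mem_image.mp h
  exact hT.notMem t ht (hf ▸ h)

/-- The summand `1` accounts for the zero class, which `T` omits. -/
theorem IsTransversal.relIndex_eq (hT : IsTransversal T Λ' Λ) :
    Λ.relIndex Λ' = T.card + 1 := by
  classical
  have hf : (QuotientAddGroup.mk' Λ).ker = Λ := QuotientAddGroup.ker_mk' Λ
  have h := AddSubgroup.relIndex_ker Λ' (QuotientAddGroup.mk' Λ)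
  rw [hf] at h
  rw [h, ← Finset.card_image_of_injOn (f := QuotientAddGroup.mk' Λ) (hT.injOn_of_ker_eq hf),
    ← Finset.card_insert_of_notMem (a := 0) (hT.zero_notMem_image hf), ← Nat.card_eq_finsetCard]
  refine Nat.card_congr (Equiv.setCongr ?_)
  rw [Finset.coe_insert, hT.insert_image_eq hf]

theorem exists_isTransversal (h : Λ.relIndex Λ' ≠ 0) : ∃ T, IsTransversal T Λ' Λ := by
  classical
  have : Finite (Λ' ⧸ Λ.addSubgroupOf Λ') :=
    have : (Λ.addSubgroupOf Λ').FiniteIndex := ⟨h⟩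
    AddSubgroup.finite_quotient_of_finiteIndex
  have := Fintype.ofFinite (Λ' ⧸ Λ.addSubgroupOf Λ')
  let r : Λ' ⧸ Λ.addSubgroupOf Λ' → G := fun x ↦ (x.out : Λ')
  have hr (x y) : r x - r y ∈ Λ ↔ x = y := by
    rw [← sub_eq_zero (a := x), ← QuotientAddGroup.out_eq' x, ← QuotientAddGroup.out_eq' y,
      ← QuotientAddGroup.mk_sub, QuotientAddGroup.eq_zero_iff, AddSubgroup.mem_addSubgroupOf]
    simp [r]
  have hr0 (x) : r x ∈ Λ ↔ x = 0 := by
    rw [← QuotientAddGroup.out_eq' x, QuotientAddGroup.eq_zero_iff, AddSubgroup.mem_addSubgroupOf]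
    simp [r]
  refine ⟨(Finset.univ.erase 0).image r, fun t ht ↦ ?_, fun t ht ↦ ?_, fun s hs t ht h ↦ ?_,
    fun x hx hxΛ ↦ ?_⟩
  · obtain ⟨x, -, rfl⟩ := Finset.mem_image.mp ht
    exact x.out.2
  · obtain ⟨x, hx, rfl⟩ := Finset.mem_image.mp ht
    rw [hr0]
    exact (Finset.mem_erase.mp hx).1
  · obtain ⟨x, -, rfl⟩ := Finset.mem_image.mp hs
    obtain ⟨y, -, rfl⟩ := Finset.mem_image.mp ht
    rw [(hr x y).mp h]
  · refine ⟨r (QuotientAddGroup.mk ⟨x, hx⟩), Finset.mem_image_of_mem _ ?_, ?_⟩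
    · simpa [QuotientAddGroup.eq_zero_iff, AddSubgroup.mem_addSubgroupOf] using hxΛ
    · have h := QuotientAddGroup.out_eq' (QuotientAddGroup.mk ⟨x, hx⟩ : Λ' ⧸ Λ.addSubgroupOf Λ')
      rw [← sub_eq_zero, ← QuotientAddGroup.mk_sub, QuotientAddGroup.eq_zero_iff,
        AddSubgroup.mem_addSubgroupOf] at h
      have h' := Λ.neg_mem h
      simpa [r] using h'

end Transversal

/-! ### Relations between exponentials of different lattices -/

section Isogeny

theorem factor_sdiff_of_mem {C : Type*} [NormedField C] {S : Set C} {z l : C} (h : l ∈ S)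
    (h0 : l ≠ 0) : factor (S \ {0}) z l = 1 - z / l :=
  factor_of_mem ⟨h, h0⟩

theorem factor_sdiff_of_notMem {C : Type*} [NormedField C] {S : Set C} {z l : C} (h : l ∉ S) :
    factor (S \ {0}) z l = 1 :=
  factor_of_notMem fun h' ↦ h h'.1

variable {F C : Type*} [Field F] [Finite F] [NormedField C] [IsUltrametricDist C] [CompleteSpace C]
  [Algebra F C] {Λ Λ' : Submodule F C}

/-- For `0 ≠ l ∈ Λ` one has `(1 - z/(l+u)) (1 + u/l) = 1 - (z-u)/l`, and `l = 0` contributes `1 -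
z/u`. Multiplying over `Λ` relates the coset product to `e^Λ(z-u)` and `e^Λ(-u)`; additivity of
`e^Λ` finishes. -/
theorem prodOver_coset (hΛ : FiniteBalls (Λ : Set C)) {u : C} (hu : u ∉ Λ)
    (hc : FiniteBalls {x | x - u ∈ Λ}) (z : C) :
    prodOver {x | x - u ∈ Λ} z = 1 - expLinear hΛ z / expLinear hΛ u := by
  classical
  set S : Set C := (Λ : Set C) \ {0} with hS
  have hSf : FiniteBalls S := hΛ.mono Set.sdiff_subset
  have hu0 : u ≠ 0 := by rintro rfl; exact hu Λ.zero_mem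
  have hf := (Equiv.hasProd_iff (Equiv.addRight u)).mpr (hasProd_factor hc z)
  have h1 := hf.mul (hasProd_factor hSf (-u))
  have h2 := (hasProd_factor hSf (z - u)).mul (hasProd_ite_eq (0 : C) (1 - z / u))
  have key : (fun l ↦ (factor {x | x - u ∈ Λ} z ∘ ⇑(Equiv.addRight u)) l * factor S (-u) l) =
      fun l ↦ factor S (z - u) l * (if l = 0 then 1 - z / u else 1) := by
    ext l
    simp only [Function.comp_apply, Equiv.coe_addRight]
    by_cases hl : l ∈ Λ
    · rw [factor_of_mem (show l + u ∈ {x | x - u ∈ Λ} by simpa using hl)]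
      by_cases hl0 : l = 0
      · subst hl0
        rw [factor_of_notMem (by simp [S]), factor_of_notMem (by simp [S])]
        simp
      · have hlS : l ∈ S := ⟨hl, hl0⟩
        rw [factor_of_mem hlS, factor_of_mem hlS, if_neg hl0]
        have : l + u ≠ 0 := fun h ↦ hu (by
          rw [eq_neg_of_add_eq_zero_right h]; exact Λ.neg_mem hl)
        field_simp
        ring
    · have hlS : l ∉ S := fun h ↦ hl h.1
      have hl0 : l ≠ 0 := by rintro rfl; exact hl Λ.zero_mem
      rw [factor_of_notMem (by simpa using hl), factor_of_notMem hlS, factor_of_notMem hlS,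
        if_neg hl0]
  rw [key] at h1
  have h3 := h1.unique h2
  have e1 : expLinear hΛ (-u) = -u * prodOver S (-u) := rfl
  have e2 : expLinear hΛ (z - u) = (z - u) * prodOver S (z - u) := rfl
  have hne : expLinear hΛ u ≠ 0 := fun h ↦ hu ((expLinear_eq_zero_iff hΛ).mp h)
  rw [map_neg] at e1
  rw [map_sub] at e2
  rw [eq_sub_iff_add_eq, eq_comm, ← sub_eq_iff_eq_add, one_sub_div hne, div_eq_iff hne]
  have e3 : expLinear hΛ u = u * prodOver S (-u) := by linear_combination -e1
  rw [← neg_sub, e2, e3]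
  have h4 : u * (1 - z / u) = u - z := by field_simp
  linear_combination -(u * h3) - prodOver S (z - u) * h4

/-- The nonzero elements of `Λ'` split into those of `Λ` and the cosets `t + Λ`, each coset giving
one factor by `prodOver_coset`. -/
theorem expSet_eq_eval (hΛ' : FiniteBalls (Λ' : Set C)) (hΛ : FiniteBalls (Λ : Set C))
    (hle : Λ ≤ Λ') {T : Finset C} (hT : IsTransversal T Λ'.toAddSubgroup Λ.toAddSubgroup) (z : C) :
    expSet (Λ' : Set C) z = expLinear hΛ z * ∏ t ∈ T, (1 - expLinear hΛ z / expLinear hΛ t) := by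
  classical
  have hc (t) (ht : t ∈ T) : FiniteBalls {x | x - t ∈ Λ} := hΛ'.mono fun x hx ↦ by
    simpa using Λ'.add_mem (hle hx) (hT.mem t ht)
  have h1 : HasProd (fun x ↦ ∏ t ∈ T, factor {x | x - t ∈ Λ} z x)
      (∏ t ∈ T, (1 - expLinear hΛ z / expLinear hΛ t)) :=
    hasProd_prod fun t ht ↦ by
      rw [← prodOver_coset hΛ (hT.notMem t ht) (hc t ht)]
      exact hasProd_factor (hc t ht) z
  have h2 := (hasProd_factor (hΛ.mono Set.sdiff_subset : FiniteBalls ((Λ : Set C) \ {0})) z).mul h1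
  have key : (fun x ↦ factor ((Λ : Set C) \ {0}) z x * ∏ t ∈ T, factor {x | x - t ∈ Λ} z x) =
      factor ((Λ' : Set C) \ {0}) z := by
    ext x
    by_cases hxΛ : x ∈ Λ
    · rw [Finset.prod_eq_one, mul_one]
      · by_cases hx0 : x = 0
        · rw [factor_of_notMem (by simp [hx0]), factor_of_notMem (by simp [hx0])]
        · rw [factor_sdiff_of_mem hxΛ hx0, factor_sdiff_of_mem (hle hxΛ) hx0]
      · intro t ht
        refine factor_of_notMem fun h ↦ hT.notMem t ht ?_
        have h3 := Λ.sub_mem hxΛ h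
        rwa [sub_sub_cancel] at h3
    · rw [factor_sdiff_of_notMem hxΛ, one_mul]
      have hx0 : x ≠ 0 := by rintro rfl; exact hxΛ Λ.zero_mem
      by_cases hx : x ∈ Λ'
      · obtain ⟨t, ht, h⟩ := hT.exists_sub_mem x hx hxΛ
        rw [factor_sdiff_of_mem hx hx0, Finset.prod_eq_single_of_mem t ht, factor_of_mem (show x ∈ {x | x - t ∈ Λ} from h)]
        intro s hs hst
        refine factor_of_notMem fun h' ↦ hst (hT.eq_of_sub_mem s hs t ht ?_)
        have h3 := Λ.sub_mem h h'
        rwa [sub_sub_sub_cancel_left] at h3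
      · rw [factor_sdiff_of_notMem hx]
        refine Finset.prod_eq_one fun t ht ↦ factor_of_notMem fun h ↦ hx ?_
        simpa using Λ'.add_mem (hle h) (hT.mem t ht)
  rw [key] at h2
  rw [expSet, (hasProd_factor (hΛ'.mono Set.sdiff_subset) z).unique h2, ← mul_assoc]
  rfl

/-- Some ball around `0` contains no nonzero element of `Λ`. On it `e^Λ` is injective, so `e^Λ`
takes infinitely many values. This gives uniqueness of the isogeny. -/
theorem polynomial_eq_of_eval_expLinear_eq [(𝓝[≠] (0 : C)).NeBot]
    (hΛ : FiniteBalls (Λ : Set C)) {P Q : C[X]}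
    (h : ∀ z, P.eval (expLinear hΛ z) = Q.eval (expLinear hΛ z)) : P = Q := by
  have hfin := (hΛ.mono Set.sdiff_subset : FiniteBalls ((Λ : Set C) \ {0})) 1
  have hU : (((Λ : Set C) \ {0}) ∩ {x | ‖x‖ ≤ 1})ᶜ ∈ 𝓝 (0 : C) :=
    hfin.isClosed.isOpen_compl.mem_nhds (by simp)
  obtain ⟨δ, hδ, hsub⟩ := Metric.mem_nhds_iff.mp (inter_mem hU (Metric.ball_mem_nhds 0 one_pos))
  have hinj : Set.InjOn (expLinear hΛ) (Metric.ball 0 δ) := fun x hx y hy hxy ↦ by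
    rw [expLinear_eq_iff] at hxy
    have hxy' : x - y ∈ Metric.ball (0 : C) δ := by
      rw [mem_ball_zero_iff] at hx hy ⊢
      rw [sub_eq_add_neg]
      rw [← norm_neg y] at hy
      exact (IsUltrametricDist.norm_add_le_max x (-y)).trans_lt (max_lt hx hy)
    obtain ⟨h1, h2⟩ := hsub hxy'
    by_contra hne
    exact h1 ⟨⟨hxy, sub_ne_zero.mpr hne⟩, by simpa using (mem_ball_zero_iff.mp h2).le⟩
  have hinf := (infinite_of_mem_nhds (0 : C) (Metric.ball_mem_nhds 0 hδ)).image hinj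
  refine eq_of_infinite_eval_eq P Q (hinf.mono ?_)
  rintro _ ⟨z, -, rfl⟩
  exact h z

/-- Multiplicativity over a family of intermediate subspaces that covers every vector outside the
smallest subspace equally often. -/
theorem prod_expSet_mul {ι : Type*} (s : Finset ι) {Z : ι → Set C} {S₀ S₁ : Set C}
    (h₁ : FiniteBalls S₁) (h0 : ∀ i ∈ s, S₀ ⊆ Z i) (h1 : ∀ i ∈ s, Z i ⊆ S₁) (h01 : S₀ ⊆ S₁)
    (m : ℕ)
    [∀ x, DecidablePred fun i ↦ x ∈ Z i]
    (hm : ∀ x ∈ S₁, x ∉ S₀ → (s.filter fun i ↦ x ∈ Z i).card = m) (z : C) :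
    (∏ i ∈ s, expSet (Z i) z) * expSet S₀ z ^ m = expSet S₀ z ^ s.card * expSet S₁ z ^ m := by
  classical
  have h₀ : FiniteBalls S₀ := h₁.mono h01
  have ha := (hasProd_prod fun i hi ↦
    hasProd_factor ((h₁.mono (h1 i hi)).mono Set.sdiff_subset : FiniteBalls (Z i \ {0})) z).mul
    ((hasProd_factor (h₀.mono Set.sdiff_subset : FiniteBalls (S₀ \ {0})) z).pow m)
  have hb := ((hasProd_factor (h₀.mono Set.sdiff_subset : FiniteBalls (S₀ \ {0})) z).pow s.card).mul
    ((hasProd_factor (h₁.mono Set.sdiff_subset : FiniteBalls (S₁ \ {0})) z).pow m)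
  -- Multiplicities of the factor at `x ≠ 0`: `s.card + m` on both sides if `x ∈ S₀`, `m` on both
  -- sides if `x ∈ S₁ \ S₀`, and none elsewhere.
  have key : (fun x ↦ (∏ i ∈ s, factor (Z i \ {0}) z x) * factor (S₀ \ {0}) z x ^ m) =
      fun x ↦ factor (S₀ \ {0}) z x ^ s.card * factor (S₁ \ {0}) z x ^ m := by
    ext x
    by_cases hx0 : x = 0
    · have : ∀ S : Set C, factor (S \ {0}) z x = 1 := fun S ↦ factor_of_notMem (by simp [hx0])
      simp [this]
    · by_cases hx : x ∈ S₀
      · rw [factor_sdiff_of_mem hx hx0, factor_sdiff_of_mem (h01 hx) hx0,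
          Finset.prod_congr rfl fun i hi ↦ factor_sdiff_of_mem (h0 i hi hx) hx0, Finset.prod_const]
      · rw [factor_sdiff_of_notMem hx, one_pow, one_pow, one_mul, mul_one]
        by_cases hx1 : x ∈ S₁
        · rw [factor_sdiff_of_mem hx1 hx0, ← hm x hx1 hx, ← Finset.prod_const, Finset.prod_filter]
          refine Finset.prod_congr rfl fun i hi ↦ ?_
          split_ifs with h
          · exact factor_sdiff_of_mem h hx0
          · exact factor_sdiff_of_notMem h
        · rw [factor_sdiff_of_notMem hx1, one_pow]
          exact Finset.prod_eq_one fun i hi ↦ factor_sdiff_of_notMem fun h ↦ hx1 (h1 i hi h)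
  rw [key] at ha
  have := ha.unique hb
  simp only [expSet, Finset.prod_mul_distrib, Finset.prod_const, mul_pow]
  linear_combination z ^ s.card * z ^ m * this

/-- Reindexing by `l ↦ a * l` leaves the quotients `z / l` unchanged; only the leading factor `z` is
scaled. -/
theorem expSet_smul {C : Type*} [NormedField C] {S : Set C} {a : C} (ha : a ≠ 0) (z : C) :
    expSet {x | a⁻¹ * x ∈ S} (a * z) = a * expSet S z := by
  have h : prodOver ({x | a⁻¹ * x ∈ S} \ {0}) (a * z) = prodOver (S \ {0}) z := by
    rw [prodOver, prodOver, ← (Equiv.mulLeft₀ a ha).tprod_eq]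
    refine tprod_congr fun x ↦ ?_
    simp only [Equiv.mulLeft₀_apply]
    by_cases hx : x ∈ S \ {0}
    · rw [factor_of_mem hx, factor_sdiff_of_mem (by simpa [ha] using hx.1) (by simpa [ha] using hx.2),
        mul_div_mul_left _ _ ha]
    · rw [factor_of_notMem hx, factor_of_notMem]
      simpa [ha] using hx
  rw [expSet, h, expSet, mul_assoc]

end Isogeny

/-! ### Discriminants as products of inverse exponential values -/

section Disc

variable {F K : Type*} [Field F] [Finite F] [Field K] [Algebra F K]
  {v : ValuationSubring K} [IsDiscreteValuationRing v] {r : ℕ}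

instance isUltrametricDistCInf : IsUltrametricDist (CInf v) :=
  IsUltrametricDist.of_normedAlgebra (KInf v)

/-- The embedding of `K` into `C_∞`. -/
def embCInf (v : ValuationSubring K) [IsDiscreteValuationRing v] : K →+* CInf v :=
  (algebraMap (KInf v) (CInf v)).comp (algebraMap K (KInf v))

instance algebraConstantsCInf : Algebra F (CInf v) :=
  ((embCInf v).comp (algebraMap F K)).toAlgebra

instance neBot_punctured_nhds_CInf : (𝓝[≠] (0 : CInf v)).NeBot :=
  Module.punctured_nhds_neBot (KInf v) (CInf v) 0

theorem expLattice_eq_expSet (Λ : AddSubgroup (CInf v)) (z : CInf v) :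
    expLattice Λ z = expSet Λ z := by
  rw [expLattice, expSet, prodOver, factor, ← tprod_subtype]
  rfl

/-- The normalized polynomial with nonzero roots `e^Λ(t)` is an isogeny, so the default value `0`
does not occur; by uniqueness it is the chosen one. -/
theorem latticeDisc_eq {Λ Λ' : Submodule F (CInf v)} (hle : Λ ≤ Λ')
    (hΛ' : FiniteBalls (Λ' : Set (CInf v))) {T : Finset (CInf v)}
    (hT : IsTransversal T Λ'.toAddSubgroup Λ.toAddSubgroup) :
    latticeDisc F Λ'.toAddSubgroup Λ.toAddSubgroup = ∏ t ∈ T, (expSet (Λ : Set (CInf v)) t)⁻¹ := by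
  classical
  have hΛ : FiniteBalls (Λ : Set (CInf v)) := hΛ'.mono hle
  have hker : (expLinear hΛ).toAddMonoidHom.ker = Λ.toAddSubgroup := by
    ext x
    exact expLinear_eq_zero_iff hΛ
  have hinj : Set.InjOn (expLinear hΛ) T := hT.injOn_of_ker_eq hker
  have h0 : 0 ∉ T.image (expLinear hΛ) := hT.zero_notMem_image hker
  have hins : insert 0 (T.image (expLinear hΛ) : Set (CInf v)) = Λ'.map (expLinear hΛ) :=
    hT.insert_image_eq hker
  set P := normalizedPoly (T.image (expLinear hΛ)) with hP
  have hiso : IsNormalizedIsogeny F Λ'.toAddSubgroup Λ.toAddSubgroup P := by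
    refine ⟨exists_eq_of_mem_support (normalizedPoly_mem_linearPolynomials h0 hins),
      coeff_one_normalizedPoly _, ?_, fun z ↦ ?_⟩
    · rw [natDegree_normalizedPoly h0, Finset.card_image_of_injOn hinj, hT.relIndex_eq]
    · rw [expLattice_eq_expSet, expLattice_eq_expSet, eval_normalizedPoly,
        Finset.prod_image hinj]
      exact expSet_eq_eval hΛ' hΛ hle hT z
  have hex : ∃ φ, IsNormalizedIsogeny F Λ'.toAddSubgroup Λ.toAddSubgroup φ := ⟨P, hiso⟩
  have huniq : hex.choose = P := by
    refine polynomial_eq_of_eval_expLinear_eq hΛ fun z ↦ ?_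
    have h1 := hex.choose_spec.exp_eq z
    have h2 := hiso.exp_eq z
    rw [expLattice_eq_expSet, expLattice_eq_expSet] at h1 h2
    exact h1.symm.trans h2
  rw [latticeDisc, dif_pos hex, huniq, hP, leadingCoeff_normalizedPoly h0,
    prod_neg_inv_eq h0 (W := (Λ'.map (expLinear hΛ)).toAddSubgroup) hins, Finset.prod_image hinj]
  rfl

theorem iOmega_smul (ω : Fin r → CInf v) (a : K) (x : Fin r → K) :
    iOmega ω (a • x) = embCInf v a * iOmega ω x := by
  simp only [iOmega, AddMonoidHom.coe_mk, ZeroHom.coe_mk, Finset.mul_sum]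
  refine Finset.sum_congr rfl fun i _ ↦ ?_
  rw [Pi.smul_apply, smul_eq_mul, map_mul, Algebra.smul_def, Algebra.smul_def, map_mul, embCInf,
    RingHom.comp_apply, mul_assoc]

/-- The lattice `Y_ω` as an `F`-subspace of `C_∞`. -/
def latticeSubmodule (Y : Submodule (coeffRing F v) (Fin r → K)) (ω : Fin r → CInf v) :
    Submodule F (CInf v) where
  __ := latticeAt Y ω
  smul_mem' c x hx := by
    obtain ⟨y, hy, rfl⟩ := hx
    refine ⟨algebraMap F K c • y, ?_, iOmega_smul ω _ y⟩
    exact Y.smul_mem (algebraMap F (coeffRing F v) c) hy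

theorem toAddSubgroup_latticeSubmodule (Y : Submodule (coeffRing F v) (Fin r → K))
    (ω : Fin r → CInf v) : (latticeSubmodule Y ω).toAddSubgroup = latticeAt Y ω := rfl

theorem latticeSubmodule_mono {Y Y' : Submodule (coeffRing F v) (Fin r → K)} (h : Y ≤ Y')
    (ω : Fin r → CInf v) : latticeSubmodule Y ω ≤ latticeSubmodule Y' ω :=
  Set.image_mono h

theorem iOmega_injective {ω : Fin r → CInf v} (hω : ω ∈ Psi v r) :
    Function.Injective (iOmega ω) := by
  rw [injective_iff_map_eq_zero]
  intro x hx
  have h := Fintype.linearIndependent_iff.mp hω (fun i ↦ algebraMap K (KInf v) (x i)) hx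
  ext i
  simpa using h i

theorem iOmega_mem_latticeSubmodule_iff {ω : Fin r → CInf v} (hω : ω ∈ Psi v r)
    {Y : Submodule (coeffRing F v) (Fin r → K)} {x : Fin r → K} :
    iOmega ω x ∈ latticeSubmodule Y ω ↔ x ∈ Y :=
  (iOmega_injective hω).mem_set_image

theorem IsTransversal.map_iOmega {ω : Fin r → CInf v} (hω : ω ∈ Psi v r)
    {Y Y' : Submodule (coeffRing F v) (Fin r → K)} {T : Finset (Fin r → K)}
    (hT : IsTransversal T Y'.toAddSubgroup Y.toAddSubgroup) :
    IsTransversal (T.map ⟨iOmega ω, iOmega_injective hω⟩) (latticeSubmodule Y' ω).toAddSubgroup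
      (latticeSubmodule Y ω).toAddSubgroup := by
  refine ⟨fun t ht ↦ ?_, fun t ht ↦ ?_, fun s hs t ht h ↦ ?_, fun x hx hxY ↦ ?_⟩
  · obtain ⟨t, ht', rfl⟩ := Finset.mem_map.mp ht
    exact ⟨t, hT.mem t ht', rfl⟩
  · obtain ⟨t, ht', rfl⟩ := Finset.mem_map.mp ht
    exact fun h ↦ hT.notMem t ht' ((iOmega_mem_latticeSubmodule_iff hω).mp h)
  · obtain ⟨s, hs', rfl⟩ := Finset.mem_map.mp hs
    obtain ⟨t, ht', rfl⟩ := Finset.mem_map.mp ht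
    simp only [Function.Embedding.coeFn_mk, ← map_sub] at h
    rw [hT.eq_of_sub_mem s hs' t ht' ((iOmega_mem_latticeSubmodule_iff hω).mp h)]
  · obtain ⟨x, hx, rfl⟩ := hx
    obtain ⟨t, ht, h⟩ := hT.exists_sub_mem x hx fun h ↦
      hxY ((iOmega_mem_latticeSubmodule_iff hω).mpr h)
    refine ⟨iOmega ω t, Finset.mem_map_of_mem _ ht, ?_⟩
    rw [← map_sub]
    exact (iOmega_mem_latticeSubmodule_iff hω).mpr h

theorem disc_eq {ω : Fin r → CInf v} (hω : ω ∈ Psi v r)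
    {Y Y' : Submodule (coeffRing F v) (Fin r → K)} (hle : Y ≤ Y')
    (hY' : FiniteBalls (iOmega ω '' (Y' : Set (Fin r → K)))) {T : Finset (Fin r → K)}
    (hT : IsTransversal T Y'.toAddSubgroup Y.toAddSubgroup) :
    disc Y' Y ω = ∏ t ∈ T, (expSet (iOmega ω '' Y) (iOmega ω t))⁻¹ := by
  rw [disc, ← toAddSubgroup_latticeSubmodule, ← toAddSubgroup_latticeSubmodule,
    latticeDisc_eq (latticeSubmodule_mono hle ω) hY' (hT.map_iOmega hω), Finset.prod_map]
  rfl

end Disc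

/-! ### Finiteness in global function fields -/

section FunctionField

variable {F K : Type*} [Field F] [Field K] [Algebra F K]

open scoped IntermediateField IntermediateField.algebraAdjoinAdjoin

/-- The transcendence degree is `1`, so `s` is a transcendence basis; `K` is then algebraic and
essentially of finite type over `F(s)`, hence finite. -/
theorem finiteDimensional_adjoin_of_transcendental [IsGlobalFunctionField F K] {s : K}
    (hs : Transcendental F s) : FiniteDimensional F⟮s⟯ K := by
  obtain ⟨t, ht, hfin⟩ := IsGlobalFunctionField.exists_finite (F := F) (K := K)
  have hess : Algebra.EssFiniteType F K := by
    have : Algebra.EssFiniteType F F⟮t⟯ :=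
      IntermediateField.essFiniteType_iff.mpr ⟨{t}, by simp⟩
    exact Algebra.EssFiniteType.comp F F⟮t⟯ K
  have hti : AlgebraicIndependent F fun _ : Unit ↦ t :=
    (algebraicIndependent_unique_type_iff (ι := Unit)).mpr ht
  have hsi : AlgebraicIndependent F fun _ : Unit ↦ s :=
    (algebraicIndependent_unique_type_iff (ι := Unit)).mpr hs
  have htb : IsTranscendenceBasis F fun _ : Unit ↦ t := by
    rw [hti.isTranscendenceBasis_iff_isAlgebraic]
    have halg : Algebra.IsAlgebraic F⟮t⟯ K := inferInstance
    have := (IsFractionRing.comap_isAlgebraic_iff (A := Algebra.adjoin F {t}) (K := F⟮t⟯)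
      (C := K)).mpr halg
    rw [Set.range_const]
    exact this
  have hsb : IsTranscendenceBasis F fun _ : Unit ↦ s := by
    refine hsi.isTranscendenceBasis_of_lift_trdeg_le_of_finite ?_
    have h := htb.lift_cardinalMk_eq_trdeg
    rw [← h]
  have halg : Algebra.IsAlgebraic F⟮s⟯ K := by
    have := hsb.isAlgebraic_field
    rwa [Set.range_const] at this
  have : Algebra.EssFiniteType F⟮s⟯ K := Algebra.EssFiniteType.of_comp F F⟮s⟯ K
  exact Algebra.finite_of_essFiniteType_of_isAlgebraic

/-- Elements of `B` that are linearly independent over `F` modulo `s` are linearly independent over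
`F(s)`. -/
theorem linearIndependent_adjoin_of_quotient {B : Subalgebra F K} {s : B}
    (hs : Transcendental F (s : K)) {ι : Type*} {x : ι → B}
    (hx : LinearIndependent F fun i ↦ Ideal.Quotient.mk (Ideal.span {s}) (x i)) :
    LinearIndependent F⟮(s : K)⟯ fun i ↦ (x i : K) := by
  rw [← LinearIndependent.iff_fractionRing (R := Algebra.adjoin F {(s : K)}), linearIndependent_iff']
  intro t g hg i hi
  have hs0 : s ≠ 0 := by
    rintro rfl
    exact hs isAlgebraic_zero
  have hg' : ∀ j, ∃ f : F[X], aeval (s : K) f = g j := fun j ↦ by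
    exact (Algebra.adjoin_singleton_eq_range_aeval F (s : K)).le (g j).2
  choose f hf using hg'
  have hrel : ∑ j ∈ t, aeval s (f j) * x j = 0 := by
    apply Subtype.val_injective
    have h2 : ∀ j, ((aeval s (f j) : B) : K) = g j := fun j ↦ by
      rw [← hf j, ← Subalgebra.coe_val, ← Polynomial.aeval_algHom_apply]
    simp only [AddSubmonoidClass.coe_finsetSum, MulMemClass.coe_mul, h2]
    simpa [Algebra.smul_def] using hg
  -- Modulo `s` the relation involves only constant coefficients, which vanish by independence.
  -- Dividing by `s` and repeating makes every power of `X` divide every coefficient.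
  have hdvd : ∀ n : ℕ, ∀ f : ι → F[X], ∑ j ∈ t, aeval s (f j) * x j = 0 →
      ∀ j ∈ t, X ^ n ∣ f j := by
    intro n
    induction n with
    | zero => simp
    | succ n ih =>
      intro f hf
      have hX : ∀ j ∈ t, X ∣ f j := by
        have h1 := congrArg (Ideal.Quotient.mk (Ideal.span {s})) hf
        have hmk : ∀ j, Ideal.Quotient.mk (Ideal.span {s}) (aeval s (f j)) =
            algebraMap F _ ((f j).coeff 0) := fun j ↦ by
          conv_lhs => rw [← Polynomial.divX_mul_X_add (f j)]
          rw [map_add, map_mul, aeval_X, aeval_C, map_add, map_mul,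
            Ideal.Quotient.eq_zero_iff_mem.mpr (Ideal.mem_span_singleton_self s), mul_zero, zero_add]
          rfl
        simp only [map_sum, map_mul, hmk, map_zero, ← Algebra.smul_def] at h1
        intro j hj
        rw [X_dvd_iff]
        exact linearIndependent_iff'.mp hx t _ h1 j hj
      choose! f' hf' using hX
      have h2 : ∑ j ∈ t, aeval s (f' j) * x j = 0 := by
        have h3 : s * ∑ j ∈ t, aeval s (f' j) * x j = 0 := by
          rw [← hf, Finset.mul_sum]
          refine Finset.sum_congr rfl fun j hj ↦ ?_
          conv_rhs => rw [hf' j hj]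
          rw [map_mul, aeval_X, mul_assoc]
        exact (mul_eq_zero.mp h3).resolve_left hs0
      intro j hj
      rw [hf' j hj, pow_succ']
      exact mul_dvd_mul_left _ (ih f' h2 j hj)
  have h0 : f i = 0 := by
    refine eq_zero_of_dvd_of_natDegree_lt (hdvd ((f i).natDegree + 1) f hrel i hi) ?_
    rw [natDegree_X_pow]
    exact Nat.lt_succ_self _
  apply Subtype.val_injective
  rw [← hf i, h0, map_zero]
  rfl

/-- Lifts of an `F`-basis of `B / (s)` are independent over `F(s)`, so the basis is finite because
`K` is finite over `F(s)`. -/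
theorem finite_quotient_span_of_transcendental [Finite F] [IsGlobalFunctionField F K]
    {B : Subalgebra F K} {s : B} (hs : Transcendental F (s : K)) :
    Finite (B ⧸ Ideal.span {s}) := by
  have := finiteDimensional_adjoin_of_transcendental hs
  let b := Module.Basis.ofVectorSpace F (B ⧸ Ideal.span {s})
  let x := fun i ↦ Function.surjInv (Ideal.Quotient.mk_surjective (I := Ideal.span {s})) (b i)
  have hx : LinearIndependent F fun i ↦ Ideal.Quotient.mk (Ideal.span {s}) (x i) := by
    simpa only [x, Function.surjInv_eq] using b.linearIndependent
  have hfin := (linearIndependent_adjoin_of_quotient hs hx).finite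
  have : Module.Finite F (B ⧸ Ideal.span {s}) := Module.Finite.of_basis b
  exact Module.finite_of_finite F

theorem transcendental_of_notMem_range [IsGlobalFunctionField F K] {x : K}
    (hx : x ∉ Set.range (algebraMap F K)) : Transcendental F x :=
  fun h ↦ hx (IsGlobalFunctionField.mem_constants x h)

/-- The integral closure of a subring of a field is the intersection of the valuation rings
containing it. -/
theorem isIntegral_of_forall_mem_valuationSubring {B : Subalgebra F K} {x : K}
    (h : ∀ w : ValuationSubring K, (B : Set K) ⊆ w → x ∈ w) : IsIntegral B x := by
  have h1 := iInf_valuationSubring_superset (s := (B : Set K))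
  have h2 : x ∈ (⨅ V : {V : ValuationSubring K // (B : Set K) ⊆ V.toSubring}, V.1.toSubring) :=
    Subring.mem_iInf.mpr fun V ↦ h V.1 V.2
  rw [h1] at h2
  have h3 : ∀ R : Subring K, R = B.toSubring → x ∈ (integralClosure R K).toSubring →
      IsIntegral B x := by
    rintro _ rfl h
    exact h
  exact h3 _ (Subring.closure_eq B.toSubring) h2

end FunctionField

/-! ### The coefficient ring is Dedekind with finite quotients -/

section CoeffRing

variable {F K : Type*} [Field F] [Finite F] [Field K] [Algebra F K] {v : ValuationSubring K}

theorem mem_coeffRing_of_isIntegral {x : K} (hx : IsIntegral (coeffRing F v) x) :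
    x ∈ coeffRing F v := by
  intro w h1 h2
  let φ : coeffRing F v →+* w := Subring.inclusion (S := (coeffRing F v).toSubring)
    (T := w.toSubring) fun y hy ↦ hy w h1 h2
  have hx' : IsIntegral w x := hx.map_of_comp_eq φ (RingHom.id K) rfl
  obtain ⟨y, hy⟩ := IsIntegrallyClosed.isIntegral_iff.mp hx'
  rw [← hy]
  exact y.2

/-- The valuation ring `v` as an `F`-algebra. -/
def valuationSubalgebra (F : Type*) {K : Type*} [Field F] [Finite F] [Field K] [Algebra F K]
    (v : ValuationSubring K) : Subalgebra F K where
  __ := v.toSubring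
  algebraMap_mem' c := algebraMap_mem_valuationSubring F v c

variable [IsGlobalFunctionField F K]

/-- An element regular at every place is integral over `F`, hence a constant. -/
theorem mem_range_of_mem_coeffRing_of_mem {x : K} (hx : x ∈ coeffRing F v) (hxv : x ∈ v) :
    x ∈ Set.range (algebraMap F K) := by
  have h : IsIntegral (⊥ : Subalgebra F K) x :=
    isIntegral_of_forall_mem_valuationSubring fun w _ ↦ by
      by_cases h1 : w = ⊤
      · rw [h1]; exact ValuationSubring.mem_top x
      by_cases h2 : w = v
      · rwa [h2]
      exact hx w h1 h2
  refine IsGlobalFunctionField.mem_constants x ?_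
  have : IsIntegral F x := isIntegral_trans (A := (⊥ : Subalgebra F K)) x h
  exact this.isAlgebraic

/-- Finiteness of functions with bounded pole at `v`, by induction on the bound. The class of
`π^(n+1) x` in the finite ring `v / (π)` determines `x` up to elements satisfying the bound for `n`;
for `n = 0` only constants remain. -/
theorem finite_setOf_mul_mem {π : K} (hπ0 : π ≠ 0) (hπ : π ∈ v) (hπ' : π⁻¹ ∉ v) (n : ℕ) :
    {x : K | x ∈ coeffRing F v ∧ π ^ n * x ∈ v}.Finite := by
  have hπF : π ∉ Set.range (algebraMap F K) := by
    rintro ⟨c, rfl⟩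
    rw [← map_inv₀] at hπ'
    exact hπ' (algebraMap_mem_valuationSubring F v _)
  let s : valuationSubalgebra F v := ⟨π, hπ⟩
  have hfin : Finite (valuationSubalgebra F v ⧸ Ideal.span {s}) :=
    finite_quotient_span_of_transcendental (transcendental_of_notMem_range hπF)
  induction n with
  | zero =>
    refine (Set.finite_range (algebraMap F K)).subset fun x hx ↦ ?_
    exact mem_range_of_mem_coeffRing_of_mem hx.1 (by simpa using hx.2)
  | succ n ih =>
    let S := {x : K | x ∈ coeffRing F v ∧ π ^ (n + 1) * x ∈ v}
    let f : S → valuationSubalgebra F v ⧸ Ideal.span {s} := fun x ↦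
      Ideal.Quotient.mk _ ⟨π ^ (n + 1) * x, x.2.2⟩
    have hfib : ∀ b ∈ Set.univ, (f ⁻¹' {b}).Finite := by
      intro b _
      rcases (f ⁻¹' {b}).eq_empty_or_nonempty with h | ⟨x₀, hx₀⟩
      · rw [h]; exact Set.finite_empty
      refine Set.Finite.of_finite_image (f := fun x : S ↦ (x : K) - x₀) (ih.subset ?_) ?_
      · rintro _ ⟨x, hx, rfl⟩
        refine ⟨sub_mem x.2.1 x₀.2.1, ?_⟩
        have h := hx.trans hx₀.symm
        rw [Ideal.Quotient.eq, Ideal.mem_span_singleton] at h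
        obtain ⟨c, hc⟩ := h
        have hc' : π ^ (n + 1) * x - π ^ (n + 1) * x₀ = π * c := congrArg Subtype.val hc
        have : π ^ n * ((x : K) - x₀) = c := by
          refine mul_left_cancel₀ hπ0 ?_
          rw [← hc']
          ring
        simp only [this]
        exact c.2
      · intro x _ y _ hxy
        exact Subtype.val_injective (sub_left_injective hxy)
    have h := Set.finite_univ.preimage' hfib
    rw [Set.preimage_univ, Set.finite_univ_iff] at h
    exact h

theorem finite_quotient_span {b : coeffRing F v} (hb : b ≠ 0) :
    Finite (coeffRing F v ⧸ Ideal.span {b}) := by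
  by_cases hbF : (b : K) ∈ Set.range (algebraMap F K)
  · obtain ⟨c, hc⟩ := hbF
    have hc' : algebraMap F (coeffRing F v) c = b := Subtype.val_injective hc
    have hc0 : c ≠ 0 := by rintro rfl; exact hb (by rw [← hc', map_zero])
    have hu : IsUnit b := hc' ▸ (IsUnit.mk0 c hc0).map _
    rw [Ideal.span_singleton_eq_top.mpr hu]
    exact Finite.of_subsingleton
  · exact finite_quotient_span_of_transcendental (transcendental_of_notMem_range hbF)

theorem finite_quotient_ideal {I : Ideal (coeffRing F v)} (hI : I ≠ ⊥) :
    Finite (coeffRing F v ⧸ I) := by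
  obtain ⟨b, hb, hb0⟩ := Submodule.exists_mem_ne_zero_of_ne_bot hI
  have := finite_quotient_span hb0
  have hle : Ideal.span {b} ≤ I := (Ideal.span_singleton_le_iff_mem I).mpr hb
  exact Finite.of_surjective _ (Ideal.Quotient.factor_surjective hle)

/-- A nonzero ideal contains some `(b)` with finite quotient, so it is generated by `b` and finitely
many further elements. -/
instance isNoetherianRing_coeffRing : IsNoetherianRing (coeffRing F v) := by
  refine (isNoetherianRing_iff_ideal_fg _).mpr fun I ↦ ?_
  by_cases hI : I = ⊥
  · rw [hI]; exact Submodule.fg_bot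
  obtain ⟨b, hb, hb0⟩ := Submodule.exists_mem_ne_zero_of_ne_bot hI
  have := finite_quotient_span hb0
  refine Submodule.fg_of_fg_map_of_fg_inf_ker (Submodule.mkQ (Ideal.span {b})) ?_ ?_
  · exact Submodule.fg_def.mpr ⟨(Submodule.map (Submodule.mkQ (Ideal.span {b})) I : Set _),
      Set.toFinite _, Submodule.span_eq _⟩
  · rw [Submodule.ker_mkQ, inf_eq_right.mpr ((Ideal.span_singleton_le_iff_mem I).mpr hb)]
    exact Submodule.fg_span_singleton b

theorem isMaximal_of_isPrime {P : Ideal (coeffRing F v)} (hP : P.IsPrime) (h0 : P ≠ ⊥) :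
    P.IsMaximal := by
  have := finite_quotient_ideal h0
  exact Ideal.Quotient.maximal_of_isField _ (Finite.isField_of_domain _)

variable {a : K} (ha : a ∈ coeffRing F v) (haF : a ∉ Set.range (algebraMap F K))
include ha haF

open scoped IntermediateField IntermediateField.algebraAdjoinAdjoin in
-- `K` is algebraic over `F[a] ⊆ A`, so each `z` has a nonzero multiple integral over `F[a]`, which
-- lies in `A` because `A` is integrally closed in `K`.
theorem isFractionRing_coeffRing : IsFractionRing (coeffRing F v) K := by
  have := finiteDimensional_adjoin_of_transcendental (transcendental_of_notMem_range haF)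
  have halg : Algebra.IsAlgebraic (Algebra.adjoin F {a}) K :=
    (IsFractionRing.comap_isAlgebraic_iff (A := Algebra.adjoin F {a}) (K := F⟮a⟯)
      (C := K)).mpr inferInstance
  have hle : Algebra.adjoin F {a} ≤ coeffRing F v := Algebra.adjoin_le (by simpa using ha)
  refine IsFractionRing.of_field _ _ fun z ↦ ?_
  obtain ⟨y, hy, hyz⟩ := (halg.isAlgebraic z).exists_integral_multiple
  have h1 : IsIntegral (coeffRing F v) (y • z) :=
    hyz.map_of_comp_eq (Subalgebra.inclusion hle).toRingHom (RingHom.id K) rfl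
  refine ⟨⟨y • z, mem_coeffRing_of_isIntegral h1⟩, ⟨y, hle y.2⟩, ?_⟩
  have hy' : (y : K) ≠ 0 := fun h ↦ hy (Subtype.val_injective h)
  change z = (y • z) / (y : K)
  rw [Algebra.smul_def, eq_div_iff hy', mul_comm]
  rfl

theorem isDedekindDomain_coeffRing : IsDedekindDomain (coeffRing F v) := by
  have := isFractionRing_coeffRing ha haF
  have h1 : IsIntegrallyClosed (coeffRing F v) :=
    (isIntegrallyClosed_iff K).mpr fun {x} hx ↦ ⟨⟨x, mem_coeffRing_of_isIntegral hx⟩, rfl⟩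
  have h2 : Ring.DimensionLEOne (coeffRing F v) := ⟨fun h0 hP ↦ isMaximal_of_isPrime hP h0⟩
  exact { }

end CoeffRing

/-! ### Lattices are discrete in `C_∞` -/

section Discreteness

variable {F K : Type*} [Field F] [Finite F] [Field K] [Algebra F K]
  {v : ValuationSubring K} [IsDiscreteValuationRing v] {r : ℕ}

theorem norm_algebraMap_KInf_le_one_iff {x : K} : ‖algebraMap K (KInf v) x‖ ≤ 1 ↔ x ∈ v := by
  rw [Valued.toNormedField.norm_le_one_iff]
  have h : Valued.v (algebraMap K (KInf v) x) =
      (IsDiscreteValuationRing.maximalIdeal v).valuation K x :=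
    IsDedekindDomain.HeightOneSpectrum.valuedAdicCompletion_eq_valuation' _ x
  rw [h]
  constructor
  · intro h
    obtain ⟨y, hy⟩ := IsDiscreteValuationRing.exists_lift_of_le_one h
    rw [← hy]
    exact y.2
  · intro h
    exact IsDedekindDomain.HeightOneSpectrum.valuation_le_one _ (⟨x, h⟩ : v)

theorem finite_setOf_norm_le [IsGlobalFunctionField F K] (R : ℝ) :
    {x : K | x ∈ coeffRing F v ∧ ‖algebraMap K (KInf v) x‖ ≤ R}.Finite := by
  obtain ⟨ϖ, hϖ⟩ := IsDiscreteValuationRing.exists_irreducible v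
  have h0 : (ϖ : K) ≠ 0 := fun h ↦ hϖ.ne_zero (Subtype.val_injective h)
  have hinv : (ϖ : K)⁻¹ ∉ v := fun h ↦ hϖ.not_isUnit
    (IsUnit.of_mul_eq_one ⟨_, h⟩ (Subtype.val_injective (mul_inv_cancel₀ h0)))
  have hlt : ‖algebraMap K (KInf v) ϖ‖ < 1 := by
    rw [← norm_algebraMap_KInf_le_one_iff, map_inv₀, norm_inv, not_le] at hinv
    exact (one_lt_inv₀ (norm_pos_iff.mpr (by simpa using h0))).mp hinv
  -- `n` is chosen so that multiplication by `ϖ ^ n` carries the ball of radius `R` into the unit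
  -- ball: a norm bound becomes a pole bound.
  obtain ⟨n, hn⟩ := exists_pow_lt_of_lt_one (inv_pos.mpr (by positivity : 0 < |R| + 1)) hlt
  refine (finite_setOf_mul_mem (F := F) h0 ϖ.2 hinv n).subset fun x hx ↦ ⟨hx.1, ?_⟩
  rw [← norm_algebraMap_KInf_le_one_iff, map_mul, map_pow, norm_mul, norm_pow]
  calc _ ≤ (|R| + 1)⁻¹ * (|R| + 1) := by
        refine mul_le_mul hn.le ?_ (norm_nonneg _) (by positivity)
        linarith [hx.2, le_abs_self R]
    _ = 1 := inv_mul_cancel₀ (by positivity)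

/-- An injective linear map from a finite-dimensional space over the complete field `K_∞` is
antilipschitz. -/
theorem exists_norm_le_mul_norm_iOmega {ω : Fin r → CInf v} (hω : ω ∈ Psi v r) :
    ∃ M : ℝ, 0 ≤ M ∧ ∀ (x : Fin r → K) (i : Fin r),
      ‖algebraMap K (KInf v) (x i)‖ ≤ M * ‖iOmega ω x‖ := by
  let f : (Fin r → KInf v) →ₗ[KInf v] CInf v := Fintype.linearCombination (KInf v) ω
  have hker : LinearMap.ker f = ⊥ :=
    LinearMap.ker_eq_bot.mpr (linearIndependent_iff_injective_fintypeLinearCombination.mp hω)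
  obtain ⟨M, -, hM⟩ := f.exists_antilipschitzWith hker
  refine ⟨M, M.2, fun x i ↦ ?_⟩
  have h := ZeroHomClass.bound_of_antilipschitz f hM fun i ↦ algebraMap K (KInf v) (x i)
  exact (norm_le_pi_norm (fun i ↦ algebraMap K (KInf v) (x i)) i).trans h

/-- After clearing a common denominator `b`, the coordinates lie in `A` and have bounded norm, which
leaves finitely many vectors. -/
theorem finiteBalls_iOmega_image [IsGlobalFunctionField F K] [IsFractionRing (coeffRing F v) K]
    {ω : Fin r → CInf v} (hω : ω ∈ Psi v r) {Y : Submodule (coeffRing F v) (Fin r → K)}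
    (hY : Y.FG) : FiniteBalls (iOmega ω '' (Y : Set (Fin r → K))) := by
  classical
  obtain ⟨M, hM0, hM⟩ := exists_norm_le_mul_norm_iOmega hω
  obtain ⟨s, rfl⟩ := hY
  obtain ⟨b, hb⟩ := IsLocalization.exist_integer_multiples_of_finset
    (nonZeroDivisors (coeffRing F v)) ((s ×ˢ Finset.univ).image fun p : (Fin r → K) × Fin r ↦ p.1 p.2)
  have hb0 : ((b : coeffRing F v) : K) ≠ 0 := fun h ↦
    nonZeroDivisors.ne_zero b.2 (Subtype.val_injective h)
  have hint : ∀ y ∈ Submodule.span (coeffRing F v) (s : Set (Fin r → K)), ∀ i,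
      ((b : coeffRing F v) : K) * y i ∈ coeffRing F v := by
    intro y hy i
    induction hy using Submodule.span_induction with
    | mem y hy =>
      obtain ⟨c, hc⟩ := hb (y i) (Finset.mem_image.mpr ⟨(y, i), by simpa using hy, rfl⟩)
      have : (c : K) = ((b : coeffRing F v) : K) * y i := hc
      rw [← this]
      exact c.2
    | zero => simp
    | add x y _ _ hx hy => rw [Pi.add_apply, mul_add]; exact add_mem hx hy
    | smul c x _ hx =>
      have : ((b : coeffRing F v) : K) * (c • x) i = c * (((b : coeffRing F v) : K) * x i) := by
        rw [Pi.smul_apply, Algebra.smul_def, mul_left_comm]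
        rfl
      rw [this]
      exact mul_mem c.2 hx
  intro R
  have hfin := finite_setOf_norm_le (F := F) (v := v)
    (‖algebraMap K (KInf v) ((b : coeffRing F v) : K)‖ * (M * R))
  have hpi := Set.Finite.pi' fun _ : Fin r ↦ hfin
  refine (hpi.image fun x ↦ iOmega ω (((b : coeffRing F v) : K)⁻¹ • x)).subset ?_
  rintro _ ⟨⟨y, hy, rfl⟩, hyR⟩
  refine ⟨((b : coeffRing F v) : K) • y, fun i ↦ ⟨hint y hy i, ?_⟩, ?_⟩
  · rw [Pi.smul_apply, smul_eq_mul, map_mul, norm_mul]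
    gcongr
    exact (hM y i).trans (by gcongr; exact hyR)
  · simp only [smul_smul, inv_mul_cancel₀ hb0, one_smul]

end Discreteness

/-! ### Subspaces through a given vector -/

section Counting

variable {k V V' : Type*} [Field k] [AddCommGroup V] [Module k V] [AddCommGroup V'] [Module k V']

/-- The number of `i`-dimensional subspaces that contain a given vector. -/
def incidence (k : Type*) {V : Type*} [Field k] [AddCommGroup V] [Module k V] (i : ℕ) (x : V) : ℕ :=
  Nat.card {W : Submodule k V // Module.finrank k W = i ∧ x ∈ W}

theorem incidence_map (i : ℕ) (e : V ≃ₗ[k] V') (x : V) :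
    incidence k i (e x) = incidence k i x := by
  refine (Nat.card_congr ((Submodule.orderIsoMapComap e).toEquiv.subtypeEquiv fun W ↦ ?_)).symm
  change _ ↔ Module.finrank k (W.map (e : V →ₗ[k] V')) = i ∧ e x ∈ W.map (e : V →ₗ[k] V')
  rw [LinearEquiv.finrank_map_eq]
  simp

theorem card_subspaces_eq (i : ℕ) (e : V ≃ₗ[k] V') :
    Nat.card {W : Submodule k V // Module.finrank k W = i} =
      Nat.card {W : Submodule k V' // Module.finrank k W = i} := by
  refine Nat.card_congr ((Submodule.orderIsoMapComap e).toEquiv.subtypeEquiv fun W ↦ ?_)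
  change _ ↔ Module.finrank k (W.map (e : V →ₗ[k] V')) = i
  rw [LinearEquiv.finrank_map_eq]

theorem exists_linearEquiv_apply_eq [FiniteDimensional k V] {x y : V} (hx : x ≠ 0) (hy : y ≠ 0) :
    ∃ e : V ≃ₗ[k] V, e x = y := by
  obtain ⟨e, he⟩ := Submodule.exists_linearEquiv_restrict_eq
    ((LinearEquiv.toSpanNonzeroSingleton k V x hx).symm ≪≫ₗ
      LinearEquiv.toSpanNonzeroSingleton k V y hy)
  refine ⟨e, (he ⟨x, Submodule.mem_span_singleton_self x⟩).symm.trans ?_⟩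
  rw [LinearEquiv.trans_apply, LinearEquiv.coord_self k V x hx,
    LinearEquiv.toSpanNonzeroSingleton_one]

/-- Linear automorphisms act transitively on nonzero vectors. -/
theorem incidence_eq [FiniteDimensional k V] (i : ℕ) {x y : V} (hx : x ≠ 0) (hy : y ≠ 0) :
    incidence k i x = incidence k i y := by
  obtain ⟨e, rfl⟩ := exists_linearEquiv_apply_eq (k := k) hx hy
  exact (incidence_map i e x).symm

/-- Double counting of the pairs of a nonzero vector and an `i`-dimensional subspace containing
it. -/
theorem incidence_mul [Finite k] [FiniteDimensional k V] (i : ℕ) {x : V} (hx : x ≠ 0) :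
    incidence k i x * (Nat.card k ^ Module.finrank k V - 1) =
      Nat.card {W : Submodule k V // Module.finrank k W = i} * (Nat.card k ^ i - 1) := by
  classical
  have : Finite V := Module.finite_of_finite k
  have hne : ∀ (U : Type _) [AddCommGroup U] [Module k U] [Module.Finite k U],
      Nat.card {u : U // u ≠ 0} = Nat.card k ^ Module.finrank k U - 1 := by
    intro U _ _ _
    have : Finite U := Module.finite_of_finite k
    have := Fintype.ofFinite U
    rw [← Module.natCard_eq_pow_finrank, Nat.card_eq_fintype_card, Nat.card_eq_fintype_card,
      Fintype.card_subtype_compl, Fintype.card_subtype_eq]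
  have e : (Σ y : {y : V // y ≠ 0}, {W : Submodule k V // Module.finrank k W = i ∧ (y : V) ∈ W}) ≃
      Σ W : {W : Submodule k V // Module.finrank k W = i}, {y : W.1 // y ≠ 0} :=
    { toFun := fun p ↦ ⟨⟨p.2.1, p.2.2.1⟩, ⟨p.1.1, p.2.2.2⟩, fun h ↦ p.1.2 (congrArg Subtype.val h)⟩
      invFun := fun p ↦ ⟨⟨p.2.1.1, fun h ↦ p.2.2 (Subtype.val_injective h)⟩, p.1.1, p.1.2, p.2.1.2⟩
      left_inv := fun _ ↦ rfl
      right_inv := fun _ ↦ rfl }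
  have := Fintype.ofFinite {y : V // y ≠ 0}
  have := Fintype.ofFinite {W : Submodule k V // Module.finrank k W = i}
  have h := Nat.card_congr e
  rw [Nat.card_sigma, Nat.card_sigma] at h
  have h1 : ∀ y : {y : V // y ≠ 0},
      Nat.card {W : Submodule k V // Module.finrank k W = i ∧ (y : V) ∈ W} = incidence k i x :=
    fun y ↦ incidence_eq i y.2 hx
  have h2 : ∀ W : {W : Submodule k V // Module.finrank k W = i},
      Nat.card {y : W.1 // y ≠ 0} = Nat.card k ^ i - 1 := fun W ↦ by rw [hne, W.2]
  simp only [h1, h2, Finset.sum_const, Finset.card_univ, smul_eq_mul,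
    ← Nat.card_eq_fintype_card] at h
  rw [hne, mul_comm] at h
  exact h

theorem incidence_le [Finite k] [FiniteDimensional k V] (i : ℕ) (x : V) :
    incidence k i x ≤ Nat.card {W : Submodule k V // Module.finrank k W = i} := by
  have : Finite V := Module.finite_of_finite k
  exact Nat.card_le_card_of_injective (fun W ↦ ⟨W.1, W.2.1⟩) fun W W' h ↦
    Subtype.val_injective (by simpa using h)

end Counting

/-! ### The Euler–Poincaré characteristic and annihilators -/

section Modules

variable {R V : Type*} [CommRing R] [AddCommGroup V] [Module R V]

/-- The exponent of `p` in the characteristic is positive exactly when `p` contains the annihilator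
of `M`. If no `s ∉ p` killed `M`, then `p` would contain it and divide the product. -/
theorem exists_notMem_smul_eq_zero {M : Type*} [AddCommGroup M] [Module R M] [Finite M]
    {p : Ideal R} (hp : p.IsMaximal) (h : ¬ p ∣ eulerPoincare R M) :
    ∃ s ∉ p, ∀ x : M, s • x = 0 := by
  classical
  have hfinR : Finite (R ⧸ Module.annihilator R M) := by
    have hf : Finite (AddMonoid.End M) := DFunLike.finite _
    exact Finite.of_injective _ (RingHom.kerLift_injective (Module.toAddMonoidEnd R M))
  -- Finite length is needed because `toNat` sends `⊤` to `0`. The localization is a quotient of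
  -- `M`: an `s ∉ P` acts injectively, hence bijectively, on the finite image of `M`.
  have hloc : ∀ P : MaximalSpectrum R,
      Module.length (Localization.AtPrime P.asIdeal)
        (LocalizedModule P.asIdeal.primeCompl M) ≠ ⊤ := by
    intro P
    have hfin : Finite (LocalizedModule P.asIdeal.primeCompl M) := by
      let g := LocalizedModule.mkLinearMap P.asIdeal.primeCompl M
      refine Finite.of_surjective g fun y ↦ ?_
      obtain ⟨⟨m, s⟩, rfl⟩ := IsLocalizedModule.mk'_surjective P.asIdeal.primeCompl g y
      have hinj := IsLocalizedModule.smul_injective g s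
      have hfin : Finite (Set.range g) := Set.finite_range g
      let φ : Set.range g → Set.range g := fun z ↦ ⟨s • z.1, by
        obtain ⟨_, m, rfl⟩ := z
        exact ⟨s • m, map_smul g (s : R) m⟩⟩
      have hφ : Function.Injective φ := fun z w h ↦
        Subtype.val_injective (hinj (congrArg Subtype.val h))
      obtain ⟨⟨_, m', rfl⟩, hm'⟩ := Finite.surjective_of_injective hφ ⟨g m, m, rfl⟩
      refine ⟨m', hinj ?_⟩
      have h1 : s • g m' = g m := congrArg Subtype.val hm'
      simp only [Function.uncurry_apply_pair]
      rw [h1, IsLocalizedModule.mk'_cancel']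
    exact Module.length_ne_top
  have hmem : ∀ P : MaximalSpectrum R,
      (Module.length (Localization.AtPrime P.asIdeal)
        (LocalizedModule P.asIdeal.primeCompl M)).toNat ≠ 0 ↔ Module.annihilator R M ≤ P.asIdeal := by
    intro P
    rw [ne_eq, ENat.toNat_eq_zero, or_iff_left (hloc P), Module.length_eq_zero_iff]
    have h1 := Module.notMem_support_iff (R := R) (M := M) (p := P.toPrimeSpectrum)
    have h2 := Module.mem_support_iff_of_finite (R := R) (M := M) (p := P.toPrimeSpectrum)
    exact (not_congr h1.symm).trans (not_not.trans h2)
  by_contra hs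
  push Not at hs
  refine h ?_
  have hann : Module.annihilator R M ≤ p := by
    intro a ha
    by_contra hap
    obtain ⟨x, hx⟩ := hs a hap
    exact hx (Module.mem_annihilator.mp ha x)
  let f : MaximalSpectrum R → Ideal R := fun P ↦ P.asIdeal ^
    (Module.length (Localization.AtPrime P.asIdeal)
      (LocalizedModule P.asIdeal.primeCompl M)).toNat
  -- With infinite support the `finprod` would be `1`. The ideals involved contain the annihilator
  -- and so inject into the ideals of a finite ring.
  have hsupp : (Function.mulSupport f).Finite := by
    refine Set.Finite.of_finite_image (f := fun P ↦
      P.asIdeal.map (Ideal.Quotient.mk (Module.annihilator R M))) (Set.toFinite _) ?_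
    have hle : ∀ P ∈ Function.mulSupport f, Module.annihilator R M ≤ P.asIdeal := by
      intro P hP
      rw [← hmem]
      intro h0
      exact hP (by simp only [f, h0, pow_zero])
    intro P hP Q hQ hPQ
    ext1
    have h1 := congrArg (Ideal.comap (Ideal.Quotient.mk (Module.annihilator R M))) hPQ
    simpa [Ideal.comap_map_of_surjective' _ Ideal.Quotient.mk_surjective, hle P hP, hle Q hQ]
      using h1
  refine (dvd_pow_self p ((hmem ⟨p, hp⟩).mpr hann)).trans ?_
  exact finprod_mem_dvd (f := f) ⟨p, hp⟩ hsupp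

end Modules

/-! ### Common denominators, finite quotients and the rank of `Y / pY` -/

section Lattices

variable {R K V : Type*} [CommRing R] [IsDomain R] [Field K] [Algebra R K] [IsFractionRing R K]
  [AddCommGroup V] [Module R V] [Module K V] [IsScalarTower R K V]

theorem exists_smul_mem_of_span_eq_top {Y : Submodule R V}
    (hY : Submodule.span K (Y : Set V) = ⊤) (x : V) : ∃ b : R, b ≠ 0 ∧ b • x ∈ Y := by
  have hx : x ∈ Submodule.span K (Y : Set V) := hY ▸ Submodule.mem_top
  induction hx using Submodule.span_induction with
  | mem x hx => exact ⟨1, one_ne_zero, by simpa using hx⟩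
  | zero => exact ⟨1, one_ne_zero, by simp⟩
  | add x y _ _ hx hy =>
    obtain ⟨a, ha, hax⟩ := hx
    obtain ⟨b, hb, hby⟩ := hy
    refine ⟨a * b, mul_ne_zero ha hb, ?_⟩
    rw [smul_add]
    refine add_mem ?_ ?_
    · rw [mul_comm, mul_smul]
      exact Y.smul_mem b hax
    · rw [mul_smul]
      exact Y.smul_mem a hby
  | smul c x _ hx =>
    obtain ⟨a, ha, hax⟩ := hx
    obtain ⟨n, d, hd, rfl⟩ := IsFractionRing.div_surjective (A := R) c
    have hd0 : d ≠ 0 := nonZeroDivisors.ne_zero hd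
    refine ⟨d * a, mul_ne_zero hd0 ha, ?_⟩
    have h : (d * a) • (algebraMap R K n / algebraMap R K d) • x = n • a • x := by
      have hd' : algebraMap R K d ≠ 0 := by simpa using hd0
      rw [← algebraMap_smul K (d * a), ← algebraMap_smul K n, ← algebraMap_smul K a, smul_smul,
        smul_smul, map_mul]
      congr 1
      field_simp
    rw [h]
    exact Y.smul_mem n hax

theorem exists_smul_mem_of_fg {Y N : Submodule R V} (hY : Submodule.span K (Y : Set V) = ⊤)
    (hN : N.FG) : ∃ b : R, b ≠ 0 ∧ ∀ x ∈ N, b • x ∈ Y := by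
  classical
  obtain ⟨s, rfl⟩ := hN
  choose b hb hbY using exists_smul_mem_of_span_eq_top (R := R) hY
  refine ⟨∏ x ∈ s, b x, Finset.prod_ne_zero_iff.mpr fun x _ ↦ hb x, fun x hx ↦ ?_⟩
  induction hx using Submodule.span_induction with
  | mem x hx =>
    rw [← Finset.prod_erase_mul s b hx, mul_smul]
    exact Y.smul_mem _ (hbY x)
  | zero => simp
  | add x y _ _ hx hy => rw [smul_add]; exact add_mem hx hy
  | smul c x _ hx => rw [smul_comm]; exact Y.smul_mem c hx

end Lattices

section FiniteQuotients

variable {R V : Type*} [CommRing R] [AddCommGroup V] [Module R V]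

theorem finite_quotient_submoduleOf {N N' : Submodule R V} (hN' : N'.FG) {b : R}
    (hb : Finite (R ⧸ Ideal.span {b})) (h : ∀ x ∈ N', b • x ∈ N) :
    Finite (N' ⧸ N.submoduleOf N') := by
  have htors : Module.IsTorsionBySet R (N' ⧸ N.submoduleOf N') (Ideal.span {b}) := by
    rintro x ⟨a, ha⟩
    obtain ⟨c, rfl⟩ := Ideal.mem_span_singleton'.mp ha
    obtain ⟨z, rfl⟩ := Submodule.Quotient.mk_surjective _ x
    change (c * b) • Submodule.Quotient.mk z = _
    rw [← Submodule.Quotient.mk_smul, Submodule.Quotient.mk_eq_zero, mul_smul]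
    exact Submodule.smul_mem _ c (h z z.2)
  let : Module (R ⧸ Ideal.span {b}) (N' ⧸ N.submoduleOf N') := htors.module
  have : IsScalarTower R (R ⧸ Ideal.span {b}) (N' ⧸ N.submoduleOf N') := htors.isScalarTower
  have : Module.Finite R N' := Module.Finite.iff_fg.mpr hN'
  have : Module.Finite (R ⧸ Ideal.span {b}) (N' ⧸ N.submoduleOf N') :=
    Module.Finite.of_restrictScalars_finite R _ _
  exact Module.finite_of_finite (R ⧸ Ideal.span {b})

theorem relIndex_ne_zero_of_smul_mem {N N' : Submodule R V} (hN' : N'.FG) {b : R}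
    (hb : Finite (R ⧸ Ideal.span {b})) (h : ∀ x ∈ N', b • x ∈ N) :
    N.toAddSubgroup.relIndex N'.toAddSubgroup ≠ 0 := by
  have : Finite (N'.toAddSubgroup ⧸ N.toAddSubgroup.addSubgroupOf N'.toAddSubgroup) :=
    finite_quotient_submoduleOf hN' hb h
  exact AddSubgroup.index_ne_zero_of_finite

end FiniteQuotients

section Fiber

variable {R K : Type*} [CommRing R] [Field K] [Algebra R K] [IsFractionRing R K]

/-- `Y` is finitely generated and torsion-free over a Dedekind domain, so its fibre at `p` has the
generic rank, which is `r` because `Y` spans `K^r`. -/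
theorem finrank_quotient_smul_top [IsDedekindDomain R] {r : ℕ} {Y : Submodule R (Fin r → K)}
    (hY : Y.IsLattice K) (p : Ideal R) [p.IsMaximal] :
    letI := Ideal.Quotient.field p
    Module.finrank (R ⧸ p) (Y ⧸ p • (⊤ : Submodule R Y)) = r := by
  let := Ideal.Quotient.field p
  have hfin : Module.Finite R Y := Module.Finite.iff_fg.mpr hY.fg
  have : Module.IsTorsionFree R K := inferInstance
  have : Module.IsTorsionFree R (Fin r → K) := inferInstance
  have h1 := Ideal.finrank_fiber_eq_finrank (M := Y) p
  have h2 : Module.finrank R Y = r := by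
    have hloc : IsLocalizedModule (nonZeroDivisors R) Y.subtype := by
      refine ⟨fun s ↦ ?_, fun x ↦ ?_, fun {x y} h ↦ ⟨1, ?_⟩⟩
      · exact (isLocalizedModule_id (nonZeroDivisors R) (Fin r → K) K).map_units s
      · obtain ⟨b, hb, hbx⟩ := exists_smul_mem_of_span_eq_top hY.span_eq_top x
        exact ⟨⟨⟨_, hbx⟩, ⟨b, mem_nonZeroDivisors_of_ne_zero hb⟩⟩, rfl⟩
      · rw [Subtype.val_injective h]
    rw [← IsLocalizedModule.finrank_eq (nonZeroDivisors R) Y.subtype le_rfl,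
      ← IsLocalization.finrank_eq K (nonZeroDivisors R) le_rfl, Module.finrank_fin_fun]
  have e1 : (R ⧸ p) ⊗[R] Y ≃ₗ[R ⧸ p] Y ⧸ p • (⊤ : Submodule R Y) :=
    (quotTensorEquivQuotSMul Y p).extendScalarsOfSurjective Ideal.Quotient.mk_surjective
  have e2 := AlgebraTensorModule.cancelBaseChange R (R ⧸ p) p.ResidueField p.ResidueField Y
  rw [← e1.finrank_eq, ← Module.finrank_baseChange (R := p.ResidueField), e2.finrank_eq]
  exact h1.trans h2

end Fiber

/-! ### Lattices between `pY` and `Y` as subspaces of `Y / pY` -/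

section Subspaces

variable {R V : Type*} [CommRing R] [AddCommGroup V] [Module R V] {p : Ideal R}
  {Y : Submodule R V}

/-- The module between `p Y` and `Y` that corresponds to a subspace of `Y / p Y`. -/
def latticeOfSubspace (W : Submodule (R ⧸ p) (Y ⧸ p • (⊤ : Submodule R Y))) : Submodule R V :=
  ((W.restrictScalars R).comap (p • (⊤ : Submodule R Y)).mkQ).map Y.subtype

theorem mem_smul_top_iff {y : Y} : y ∈ p • (⊤ : Submodule R Y) ↔ (y : V) ∈ p • Y := by
  have h : (p • (⊤ : Submodule R Y)).map Y.subtype = p • Y := by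
    rw [Submodule.map_smul'', Submodule.map_top, Submodule.range_subtype]
  rw [← h]
  exact ⟨fun hy ↦ ⟨y, hy, rfl⟩, fun ⟨z, hz, e⟩ ↦ Subtype.val_injective e ▸ hz⟩

variable {W : Submodule (R ⧸ p) (Y ⧸ p • (⊤ : Submodule R Y))}

theorem coe_mem_latticeOfSubspace_iff {y : Y} :
    (y : V) ∈ latticeOfSubspace W ↔ (p • (⊤ : Submodule R Y)).mkQ y ∈ W :=
  ⟨fun ⟨_, hz, e⟩ ↦ Subtype.val_injective e ▸ hz, fun hy ↦ ⟨y, hy, rfl⟩⟩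

theorem latticeOfSubspace_le : latticeOfSubspace W ≤ Y := by
  rintro _ ⟨y, -, rfl⟩
  exact y.2

theorem smul_le_latticeOfSubspace : p • Y ≤ latticeOfSubspace W := fun x hx ↦ by
  have hy : x ∈ Y := Submodule.smul_le_right hx
  refine (coe_mem_latticeOfSubspace_iff (y := ⟨x, hy⟩)).mpr ?_
  rw [Submodule.mkQ_apply, (Submodule.Quotient.mk_eq_zero _).mpr (mem_smul_top_iff.mpr hx)]
  exact W.zero_mem

theorem latticeOfSubspace_injective :
    Function.Injective (latticeOfSubspace : Submodule (R ⧸ p) (Y ⧸ p • (⊤ : Submodule R Y)) → _) := by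
  intro W W' h
  ext x
  obtain ⟨y, rfl⟩ := Submodule.mkQ_surjective _ x
  rw [← coe_mem_latticeOfSubspace_iff, h, coe_mem_latticeOfSubspace_iff]

theorem exists_latticeOfSubspace_eq {Z : Submodule R V} (h1 : p • Y ≤ Z) (h2 : Z ≤ Y) :
    ∃ W : Submodule (R ⧸ p) (Y ⧸ p • (⊤ : Submodule R Y)), latticeOfSubspace W = Z := by
  let W' := (Z.submoduleOf Y).map (p • (⊤ : Submodule R Y)).mkQ
  let W : Submodule (R ⧸ p) (Y ⧸ p • (⊤ : Submodule R Y)) :=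
    { W' with
      smul_mem' := fun c x hx ↦ by
        obtain ⟨a, rfl⟩ := Ideal.Quotient.mk_surjective c
        exact W'.smul_mem a hx }
  refine ⟨W, le_antisymm ?_ fun z hz ↦ ?_⟩
  · rintro _ ⟨y, ⟨z, hz, hzy⟩, rfl⟩
    have h3 : z - y ∈ p • (⊤ : Submodule R Y) := (Submodule.Quotient.eq _).mp hzy
    have h4 := h1 (mem_smul_top_iff.mp h3)
    have h5 := Z.sub_mem hz h4
    simpa using h5
  · exact (coe_mem_latticeOfSubspace_iff (y := ⟨z, h2 hz⟩)).mpr ⟨⟨z, h2 hz⟩, hz, rfl⟩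

theorem natCard_quotient_latticeOfSubspace (W : Submodule (R ⧸ p) (Y ⧸ p • (⊤ : Submodule R Y))) :
    Nat.card (latticeOfSubspace W ⧸ (p • Y).submoduleOf (latticeOfSubspace W)) = Nat.card W := by
  let f : latticeOfSubspace W →ₗ[R] Y ⧸ p • (⊤ : Submodule R Y) :=
    (p • (⊤ : Submodule R Y)).mkQ.comp (Submodule.inclusion latticeOfSubspace_le)
  have hker : LinearMap.ker f = (p • Y).submoduleOf (latticeOfSubspace W) := by
    ext x
    rw [LinearMap.mem_ker, LinearMap.comp_apply, Submodule.mkQ_apply,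
      Submodule.Quotient.mk_eq_zero, mem_smul_top_iff]
    rfl
  have hrange : LinearMap.range f = W.restrictScalars R := by
    ext x
    constructor
    · rintro ⟨y, rfl⟩
      exact coe_mem_latticeOfSubspace_iff.mp y.2
    · intro hx
      obtain ⟨y, rfl⟩ := Submodule.mkQ_surjective _ x
      exact ⟨⟨y, coe_mem_latticeOfSubspace_iff.mpr hx⟩, rfl⟩
  rw [← hker]
  exact (Nat.card_congr f.quotKerEquivRange.toEquiv).trans
    (Nat.card_congr (LinearEquiv.ofEq _ _ hrange).toEquiv)

theorem natCard_quotient_eq_pow_quotientDim (hp : p.IsMaximal) [Finite (R ⧸ p)]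
    {Z : Submodule R V} (h : Z ≤ Y) [Finite (Z ⧸ (p • Y).submoduleOf Z)] :
    Nat.card (Z ⧸ (p • Y).submoduleOf Z) = Nat.card (R ⧸ p) ^ quotientDim p h := by
  let := Ideal.Quotient.field p
  let : Module (R ⧸ p) (Z ⧸ (p • Y).submoduleOf Z) := (isTorsionBySet_quotient p h).module
  exact Module.natCard_eq_pow_finrank

/-- Both dimensions are read off from cardinalities, which avoids matching the two `R / p`-module
structures. -/
theorem quotientDim_latticeOfSubspace (hp : p.IsMaximal) [Finite (R ⧸ p)]
    [Finite (Y ⧸ p • (⊤ : Submodule R Y))]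
    (W : Submodule (R ⧸ p) (Y ⧸ p • (⊤ : Submodule R Y))) (h : latticeOfSubspace W ≤ Y) :
    quotientDim p h = Module.finrank (R ⧸ p) W := by
  let := Ideal.Quotient.field p
  have h1 := natCard_quotient_latticeOfSubspace W
  have hfin : Finite (latticeOfSubspace W ⧸ (p • Y).submoduleOf (latticeOfSubspace W)) := by
    refine Nat.finite_of_card_ne_zero ?_
    rw [h1]
    exact Nat.card_pos.ne'
  have h2 := natCard_quotient_eq_pow_quotientDim hp h
  rw [h1, Module.natCard_eq_pow_finrank (K := R ⧸ p)] at h2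
  exact (Nat.pow_right_injective (Finite.one_lt_card (α := R ⧸ p)) h2).symm

end Subspaces

/-! ### Consequences of coprimality and common representatives -/

section Comaximal

variable {R V : Type*} [CommRing R] [AddCommGroup V] [Module R V] {p : Ideal R}
  {Y Y' : Submodule R V} {s : R}

theorem exists_mul_add_eq_one (hp : p.IsMaximal) (hs : s ∉ p) : ∃ a, ∃ b ∈ p, a * s + b = 1 := by
  obtain ⟨a, b, hb, h⟩ := hp.exists_inv hs
  exact ⟨a, b, hb, h⟩

/-- Write `1 = a s + b` with `b ∈ p`; then `y = a s y + b y` is the required decomposition. The next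
lemma uses the same identity, with `s • pY' ⊆ pY`. -/
theorem sup_smul_eq_of_notMem (hp : p.IsMaximal) (hs : s ∉ p) (hle : Y ≤ Y')
    (hsY : ∀ y ∈ Y', s • y ∈ Y) : Y ⊔ p • Y' = Y' := by
  obtain ⟨a, b, hb, h⟩ := exists_mul_add_eq_one hp hs
  refine le_antisymm (sup_le hle Submodule.smul_le_right) fun y hy ↦ ?_
  rw [← one_smul R y, ← h, add_smul, mul_smul]
  exact Submodule.add_mem_sup (Y.smul_mem a (hsY y hy)) (Submodule.smul_mem_smul hb hy)

theorem inf_smul_le_of_notMem (hp : p.IsMaximal) (hs : s ∉ p) (hsY : ∀ y ∈ Y', s • y ∈ Y) :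
    Y ⊓ p • Y' ≤ p • Y := by
  obtain ⟨a, b, hb, h⟩ := exists_mul_add_eq_one hp hs
  rintro y ⟨hy, hy'⟩
  have hsy : s • y ∈ p • Y := Submodule.smul_induction_on hy'
    (fun c hc z hz ↦ by rw [smul_comm]; exact Submodule.smul_mem_smul hc (hsY z hz))
    (fun x z hx hz ↦ by rw [smul_add]; exact add_mem hx hz)
  rw [← one_smul R y, ← h, add_smul, mul_smul]
  exact add_mem (Submodule.smul_mem _ a hsy) (Submodule.smul_mem_smul hb hy)

end Comaximal

section Transversal

variable {R V : Type*} [CommRing R] [AddCommGroup V] [Module R V] {A B Z : Submodule R V}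
  {T : Finset V}

/-- The hypotheses give `B / A ≅ (Z + B) / Z`, so one `T` serves all `Z` simultaneously. -/
theorem IsTransversal.sup (hT : IsTransversal T B.toAddSubgroup A.toAddSubgroup) (hA : A ≤ Z)
    (hZ : Z ⊓ B ≤ A) : IsTransversal T (Z ⊔ B).toAddSubgroup Z.toAddSubgroup := by
  refine ⟨fun t ht ↦ Submodule.mem_sup_right (hT.mem t ht),
    fun t ht h ↦ hT.notMem t ht (hZ ⟨h, hT.mem t ht⟩),
    fun s hs t ht h ↦ hT.eq_of_sub_mem s hs t ht
      (hZ ⟨h, B.sub_mem (hT.mem s hs) (hT.mem t ht)⟩), fun x hx hxZ ↦ ?_⟩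
  obtain ⟨z, hz, b, hb, rfl⟩ := Submodule.mem_sup.mp hx
  have hbA : b ∉ A.toAddSubgroup := fun h ↦ hxZ (Z.add_mem hz (hA h))
  obtain ⟨t, ht, h⟩ := hT.exists_sub_mem b hb hbA
  refine ⟨t, ht, ?_⟩
  rw [add_sub_assoc]
  exact Z.add_mem hz (hA h)

theorem IsTransversal.smul {c : R} (hc : Function.Injective fun x : V ↦ c • x)
    (hT : IsTransversal T B.toAddSubgroup A.toAddSubgroup) :
    IsTransversal (T.map ⟨_, hc⟩) (Ideal.span {c} • B).toAddSubgroup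
      (Ideal.span {c} • A).toAddSubgroup := by
  have hspan : ∀ {N : Submodule R V} {x}, x ∈ Ideal.span {c} • N ↔ ∃ y ∈ N, c • y = x := by
    intro N x
    rw [Submodule.ideal_span_singleton_smul, Submodule.mem_smul_pointwise_iff_exists]
  have hmem : ∀ {N : Submodule R V} {x}, c • x ∈ Ideal.span {c} • N ↔ x ∈ N := fun {N x} ↦ by
    rw [hspan]
    exact ⟨fun ⟨y, hy, h⟩ ↦ hc h ▸ hy, fun h ↦ ⟨x, h, rfl⟩⟩
  refine ⟨fun t ht ↦ ?_, fun t ht ↦ ?_, fun s hs t ht h ↦ ?_, fun x hx hxA ↦ ?_⟩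
  · obtain ⟨t, ht', rfl⟩ := Finset.mem_map.mp ht
    exact hmem.mpr (hT.mem t ht')
  · obtain ⟨t, ht', rfl⟩ := Finset.mem_map.mp ht
    exact fun h ↦ hT.notMem t ht' (hmem.mp h)
  · obtain ⟨s, hs', rfl⟩ := Finset.mem_map.mp hs
    obtain ⟨t, ht', rfl⟩ := Finset.mem_map.mp ht
    simp only [Function.Embedding.coeFn_mk, ← smul_sub] at h
    rw [hT.eq_of_sub_mem s hs' t ht' (hmem.mp h)]
  · obtain ⟨y, hy, rfl⟩ := hspan.mp hx
    obtain ⟨t, ht, h⟩ := hT.exists_sub_mem y hy fun h ↦ hxA (hmem.mpr h)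
    refine ⟨c • t, Finset.mem_map.mpr ⟨t, ht, rfl⟩, ?_⟩
    rw [← smul_sub]
    exact hmem.mpr h

end Transversal

/-! ### Lattices of type `i` and their incidence numbers -/

section Types

variable {R K : Type*} [CommRing R] [Field K] [Algebra R K] {r : ℕ} {Y : Submodule R (Fin r → K)}
  {p : Ideal R}

theorem isLattice_of_smul_le [IsDomain R] [IsNoetherianRing R] [IsFractionRing R K]
    (hY : Y.IsLattice K) (hp0 : p ≠ ⊥) {Z : Submodule R (Fin r → K)} (h1 : p • Y ≤ Z)
    (h2 : Z ≤ Y) : Z.IsLattice K := by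
  refine ⟨hY.fg.of_le h2, ?_⟩
  obtain ⟨b, hb, hb0⟩ := Submodule.exists_mem_ne_zero_of_ne_bot hp0
  rw [eq_top_iff, ← hY.span_eq_top]
  refine Submodule.span_le.mpr fun y hy ↦ ?_
  have hb0' : algebraMap R K b ≠ 0 := by simpa using hb0
  have h : y = (algebraMap R K b)⁻¹ • (b • y) := by
    rw [← algebraMap_smul K b, inv_smul_smul₀ hb0']
  rw [SetLike.mem_coe, h]
  exact Submodule.smul_mem _ _ (Submodule.subset_span (h1 (Submodule.smul_mem_smul hb hy)))

theorem finite_quotient_smul_top (hY : Y.FG) [Finite (R ⧸ p)] :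
    Finite (Y ⧸ p • (⊤ : Submodule R Y)) := by
  have : Module.Finite R Y := Module.Finite.iff_fg.mpr hY
  have : Module.Finite (R ⧸ p) (Y ⧸ p • (⊤ : Submodule R Y)) :=
    Module.Finite.of_restrictScalars_finite R _ _
  exact Module.finite_of_finite (R ⧸ p)

open Classical in
-- Here `m` is the incidence number of a nonzero vector of `Y / pY`; a vector of `Y` outside `pY`
-- has nonzero image there, so it has this incidence number too.
theorem exists_image_latticeOfSubspace_eq [IsDedekindDomain R] [IsFractionRing R K]
    (hY : Y.IsLattice K) (hp : p.IsMaximal) [Finite (R ⧸ p)] {i : ℕ} (hi : i < r) :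
    ∃ m ≤ grassmannCard p r i, m * (Nat.card (R ⧸ p) ^ r - 1) =
        grassmannCard p r i * (Nat.card (R ⧸ p) ^ i - 1) ∧
      ∃ L : Finset (Submodule R (Fin r → K)), (L : Set _) = latticeOfSubspace ''
        {W : Submodule (R ⧸ p) (Y ⧸ p • (⊤ : Submodule R Y)) | Module.finrank (R ⧸ p) W = i} ∧
        L.card = grassmannCard p r i ∧
        ∀ y ∈ Y, y ∉ p • Y → (L.filter fun Z ↦ y ∈ Z).card = m := by
  let := Ideal.Quotient.field p
  let Q := Y ⧸ p • (⊤ : Submodule R Y)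
  have hQ : Finite Q := finite_quotient_smul_top hY.fg
  have : Module.Finite (R ⧸ p) Q := Module.Finite.of_finite
  have hrank : Module.finrank (R ⧸ p) Q = r := finrank_quotient_smul_top hY p
  have hc : Nat.card {W : Submodule (R ⧸ p) Q // Module.finrank (R ⧸ p) W = i} =
      grassmannCard p r i :=
    card_subspaces_eq i (LinearEquiv.ofFinrankEq _ _ (by rw [hrank, Module.finrank_fin_fun]))
  have : Nontrivial Q := Module.nontrivial_of_finrank_pos (R := R ⧸ p) (by omega)
  obtain ⟨x, hx⟩ := exists_ne (0 : Q)
  have hfin : ((latticeOfSubspace : Submodule (R ⧸ p) Q → _) ''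
      {W | Module.finrank (R ⧸ p) W = i}).Finite := (Set.toFinite _).image _
  refine ⟨incidence (R ⧸ p) i x, hc ▸ incidence_le i x, ?_, hfin.toFinset,
    hfin.coe_toFinset, ?_, fun y hy hyp ↦ ?_⟩
  · rw [← hc, ← incidence_mul i hx, hrank]
  · rw [← Set.ncard_eq_toFinset_card _ hfin,
      Set.ncard_image_of_injective _ latticeOfSubspace_injective, ← hc]
    rfl
  · have hy0 : (p • (⊤ : Submodule R Y)).mkQ ⟨y, hy⟩ ≠ 0 := fun h ↦
      hyp (mem_smul_top_iff.mp ((Submodule.Quotient.mk_eq_zero _).mp h))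
    rw [incidence_eq i hx hy0, ← Set.ncard_coe_finset]
    have h : ((hfin.toFinset.filter fun Z ↦ y ∈ Z : Finset _) : Set _) = latticeOfSubspace ''
        {W : Submodule (R ⧸ p) Q | Module.finrank (R ⧸ p) W = i ∧
          (p • (⊤ : Submodule R Y)).mkQ ⟨y, hy⟩ ∈ W} := by
      ext Z
      rw [Finset.coe_filter, Set.mem_ofPred_eq, hfin.mem_toFinset]
      constructor
      · rintro ⟨⟨W, hW, rfl⟩, hyW⟩
        exact ⟨W, ⟨hW, (coe_mem_latticeOfSubspace_iff (y := ⟨y, hy⟩)).mp hyW⟩, rfl⟩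
      · rintro ⟨W, ⟨hW, hyW⟩, rfl⟩
        exact ⟨⟨W, hW, rfl⟩, (coe_mem_latticeOfSubspace_iff (y := ⟨y, hy⟩)).mpr hyW⟩
    rw [h, Set.ncard_image_of_injective _ latticeOfSubspace_injective]
    rfl

theorem natCard_quotient_eq_pow {F : Type*} [Field F] [Algebra F R] [Finite (R ⧸ p)] :
    Nat.card (R ⧸ p) = Nat.card F ^ Module.finrank F (R ⧸ p) :=
  have : Module.Finite F (R ⧸ p) := Module.Finite.of_finite
  Module.natCard_eq_pow_finrank

theorem one_lt_natCard_quotient [Finite (R ⧸ p)] (hp : p ≠ ⊤) : 1 < Nat.card (R ⧸ p) :=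
  have : Nontrivial (R ⧸ p) := Ideal.Quotient.nontrivial_iff.mpr hp
  Finite.one_lt_card

end Types

theorem latticesOfType_eq_image {F K : Type*} [Field F] [Finite F] [Field K] [Algebra F K]
    {v : ValuationSubring K} {r : ℕ} [IsNoetherianRing (coeffRing F v)]
    [IsFractionRing (coeffRing F v) K] {Y : Submodule (coeffRing F v) (Fin r → K)}
    {p : Ideal (coeffRing F v)} (hY : Y.IsLattice K) (hp : p.IsMaximal) (hp0 : p ≠ ⊥)
    [Finite (coeffRing F v ⧸ p)] (i : ℕ) :
    latticesOfType Y p i = latticeOfSubspace ''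
      {W : Submodule (coeffRing F v ⧸ p) (Y ⧸ p • (⊤ : Submodule (coeffRing F v) Y)) |
        Module.finrank (coeffRing F v ⧸ p) W = i} := by
  have := finite_quotient_smul_top (p := p) hY.fg
  ext Z
  constructor
  · rintro ⟨-, h1, h2, h3⟩
    obtain ⟨W, rfl⟩ := exists_latticeOfSubspace_eq h1 h2
    exact ⟨W, (quotientDim_latticeOfSubspace hp W h2).symm.trans h3, rfl⟩
  · rintro ⟨W, hW, rfl⟩
    exact ⟨isLattice_of_smul_le hY hp0 smul_le_latticeOfSubspace latticeOfSubspace_le,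
      smul_le_latticeOfSubspace, latticeOfSubspace_le,
      (quotientDim_latticeOfSubspace hp W latticeOfSubspace_le).trans hW⟩

theorem exists_notMem_forall_smul_mem {F K : Type*} [Field F] [Finite F] [Field K] [Algebra F K]
    [IsGlobalFunctionField F K] {v : ValuationSubring K} {r : ℕ} [IsFractionRing (coeffRing F v) K]
    [IsDedekindDomain (coeffRing F v)] {Y Y' : Submodule (coeffRing F v) (Fin r → K)}
    {p : Ideal (coeffRing F v)} (hY : Y.IsLattice K) (hY' : Y'.FG) (hp : p.IsMaximal)
    (hcop : ¬ p ∣ eulerPoincare (coeffRing F v) (Y' ⧸ Y.submoduleOf Y')) :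
    ∃ s ∉ p, ∀ y ∈ Y', s • y ∈ Y := by
  obtain ⟨b, hb, h⟩ := exists_smul_mem_of_fg hY.span_eq_top hY'
  have := finite_quotient_submoduleOf hY' (finite_quotient_span hb) h
  obtain ⟨s, hs, hs'⟩ := exists_notMem_smul_eq_zero hp hcop
  refine ⟨s, hs, fun y hy ↦ ?_⟩
  have h1 := hs' (Submodule.Quotient.mk ⟨y, hy⟩)
  rw [← Submodule.Quotient.mk_smul, Submodule.Quotient.mk_eq_zero] at h1
  exact h1

/-! ### The Hecke product -/

section Hecke

variable {F K : Type*} [Field F] [Finite F] [Field K] [Algebra F K] [IsGlobalFunctionField F K]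
  {v : ValuationSubring K} [IsDiscreteValuationRing v] {r : ℕ}
  [IsFractionRing (coeffRing F v) K] {Y Y' : Submodule (coeffRing F v) (Fin r → K)}
  {p : Ideal (coeffRing F v)} {ω : Fin r → CInf v}

theorem expSet_iOmega_ne_zero (hω : ω ∈ Psi v r) (hY : Y.FG) {x : Fin r → K} (hx : x ∉ Y) :
    expSet (iOmega ω '' (Y : Set (Fin r → K))) (iOmega ω x) ≠ 0 := fun h ↦
  hx ((iOmega_injective hω).mem_set_image.mp ((expSet_eq_zero_iff
    (finiteBalls_iOmega_image hω hY) ⟨0, Y.zero_mem, map_zero _⟩).mp h))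

theorem disc_ne_zero (hω : ω ∈ Psi v r) (hle : Y ≤ Y') (hY' : Y'.FG)
    (h : Y.toAddSubgroup.relIndex Y'.toAddSubgroup ≠ 0) : disc Y' Y ω ≠ 0 := by
  obtain ⟨T, hT⟩ := exists_isTransversal h
  rw [disc_eq hω hle (finiteBalls_iOmega_image hω hY') hT]
  exact Finset.prod_ne_zero_iff.mpr fun t ht ↦
    inv_ne_zero (expSet_iOmega_ne_zero hω (hY'.of_le hle) (hT.notMem t ht))

/-- Representatives may be scaled by `n`. Each of the `[Y' : Y] - 1` inverse exponential values then
acquires a factor `n⁻¹`. -/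
theorem disc_span_singleton_smul (hω : ω ∈ Psi v r) (hle : Y ≤ Y') (hY' : Y'.FG)
    (h : Y.toAddSubgroup.relIndex Y'.toAddSubgroup ≠ 0) {n : coeffRing F v} (hn : n ≠ 0) :
    disc (Ideal.span {n} • Y') (Ideal.span {n} • Y) ω =
      embCInf v n ^ (1 - (Y.toAddSubgroup.relIndex Y'.toAddSubgroup : ℤ)) * disc Y' Y ω := by
  obtain ⟨T, hT⟩ := exists_isTransversal h
  have hn' : (n : K) ≠ 0 := fun h ↦ hn (Subtype.val_injective h)
  have hn0 : embCInf v n ≠ 0 := (_root_.map_ne_zero _).mpr hn'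
  have hinj : Function.Injective fun x : Fin r → K ↦ n • x := fun x y h ↦
    smul_right_injective _ hn' h
  have hset : iOmega ω '' ((Ideal.span {n} • Y : Submodule (coeffRing F v) (Fin r → K)) : Set _) =
      {x | (embCInf v n)⁻¹ * x ∈ iOmega ω '' (Y : Set (Fin r → K))} := by
    ext x
    constructor
    · rintro ⟨y, hy, rfl⟩
      rw [SetLike.mem_coe, Submodule.ideal_span_singleton_smul,
        Submodule.mem_smul_pointwise_iff_exists] at hy
      obtain ⟨z, hz, rfl⟩ := hy
      refine ⟨z, hz, ?_⟩
      rw [Subalgebra.smul_def, iOmega_smul, inv_mul_cancel_left₀ hn0]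
    · rintro ⟨y, hy, h⟩
      refine ⟨n • y, Submodule.smul_mem_smul (Ideal.mem_span_singleton_self n) hy, ?_⟩
      rw [Subalgebra.smul_def, iOmega_smul, h, mul_inv_cancel_left₀ hn0]
  rw [disc_eq hω (Submodule.smul_mono le_rfl hle) (finiteBalls_iOmega_image hω
    (hY'.of_le Submodule.smul_le_right)) (hT.smul hinj), Finset.prod_map, hset,
    disc_eq hω hle (finiteBalls_iOmega_image hω hY') hT, hT.relIndex_eq]
  have hterm : ∀ t ∈ T, (expSet {x | (embCInf v n)⁻¹ * x ∈ iOmega ω '' (Y : Set (Fin r → K))}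
      (iOmega ω (n • t)))⁻¹ =
        (embCInf v n)⁻¹ * (expSet (iOmega ω '' (Y : Set (Fin r → K))) (iOmega ω t))⁻¹ := by
    intro t _
    rw [Subalgebra.smul_def, iOmega_smul, expSet_smul hn0, mul_inv]
  refine (Finset.prod_congr rfl hterm).trans ?_
  rw [Finset.prod_mul_distrib, Finset.prod_const]
  have he : (1 - ((T.card + 1 : ℕ) : ℤ)) = -(T.card : ℤ) := by push_cast; ring
  rw [he, zpow_neg, zpow_natCast, inv_pow]

open Classical in
-- With common representatives `T`, the products over `Z` and over `t` can be exchanged, and the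
-- claim becomes `prod_expSet_mul` at each `t`.
theorem heckeDisc_eq (hω : ω ∈ Psi v r) (hle : Y ≤ Y') (hY' : Y'.FG) (hp : p.IsMaximal)
    {s : coeffRing F v} (hs : s ∉ p) (hsY : ∀ y ∈ Y', s • y ∈ Y)
    (h : (p • Y).toAddSubgroup.relIndex (p • Y').toAddSubgroup ≠ 0) {i m e : ℕ}
    {L : Finset (Submodule (coeffRing F v) (Fin r → K))}
    (hL : (L : Set _) = latticesOfType Y p i) (hcard : L.card = e + m)
    (hm : ∀ y ∈ Y, y ∉ p • Y → (L.filter fun Z ↦ y ∈ Z).card = m) :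
    heckeDisc p i Y' Y ω = disc (p • Y') (p • Y) ω ^ e * disc Y' Y ω ^ m := by
  obtain ⟨T, hT⟩ := exists_isTransversal h
  have hinf : Y ⊓ p • Y' ≤ p • Y := inf_smul_le_of_notMem hp hs hsY
  have hLZ : ∀ Z ∈ L, p • Y ≤ Z ∧ Z ≤ Y := fun Z hZ ↦ by
    obtain ⟨-, h1, h2, -⟩ := hL.subset (Finset.mem_coe.mpr hZ)
    exact ⟨h1, h2⟩
  have hT1 : ∀ Z, p • Y ≤ Z → Z ≤ Y →
      IsTransversal T (Z ⊔ p • Y').toAddSubgroup Z.toAddSubgroup :=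
    fun Z h1 h2 ↦ hT.sup h1 ((inf_le_inf_right _ h2).trans hinf)
  have hdisc : ∀ Z, p • Y ≤ Z → Z ≤ Y → disc (Z ⊔ p • Y') Z ω =
      ∏ t ∈ T, (expSet (iOmega ω '' (Z : Set (Fin r → K))) (iOmega ω t))⁻¹ := fun Z h1 h2 ↦
    disc_eq hω le_sup_left (finiteBalls_iOmega_image hω
      (hY'.of_le (sup_le (h2.trans hle) Submodule.smul_le_right))) (hT1 Z h1 h2)
  -- The case `Z = Y`, where `Y + pY' = Y'`.
  have hY : disc Y' Y ω = _ := sup_smul_eq_of_notMem hp hs hle hsY ▸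
    hdisc Y Submodule.smul_le_right le_rfl
  have hprod : heckeDisc p i Y' Y ω = ∏ Z ∈ L, disc (Z ⊔ p • Y') Z ω := by
    rw [heckeDisc, ← hL]
    exact finprod_mem_coe_finset _ _
  rw [hprod, Finset.prod_congr rfl fun Z hZ ↦ hdisc Z (hLZ Z hZ).1 (hLZ Z hZ).2,
    Finset.prod_comm, hY, disc_eq hω (Submodule.smul_mono le_rfl hle)
      (finiteBalls_iOmega_image hω (hY'.of_le Submodule.smul_le_right)) hT,
    ← Finset.prod_pow, ← Finset.prod_pow, ← Finset.prod_mul_distrib]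
  refine Finset.prod_congr rfl fun t ht ↦ ?_
  rw [Finset.prod_inv_distrib, inv_pow, inv_pow, ← mul_inv, inv_inj]
  have hYfg : Y.FG := hY'.of_le hle
  have h0 := expSet_iOmega_ne_zero hω (hYfg.of_le Submodule.smul_le_right) (hT.notMem t ht)
  have key := prod_expSet_mul L (Z := fun Z ↦ iOmega ω '' (Z : Set (Fin r → K)))
    (S₀ := iOmega ω '' ((p • Y : Submodule (coeffRing F v) (Fin r → K)) : Set (Fin r → K)))
    (finiteBalls_iOmega_image hω hYfg)
    (fun Z hZ ↦ Set.image_mono (hLZ Z hZ).1) (fun Z hZ ↦ Set.image_mono (hLZ Z hZ).2)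
    (Set.image_mono Submodule.smul_le_right) m (by
      rintro _ ⟨y, hy, rfl⟩ hyp
      rw [← hm y hy fun h ↦ hyp ⟨y, h, rfl⟩]
      simp only [(iOmega_injective hω).mem_set_image, SetLike.mem_coe]) (iOmega ω t)
  rw [hcard, pow_add, mul_right_comm] at key
  -- The cancelled factor is `e^{pY}(t)^m`, nonzero because `t ∉ pY`.
  exact mul_right_cancel₀ (pow_ne_zero m h0) key

end Hecke

/-- This identifies the exponent: `(c - m)(Q^r - 1) = c(Q^r - Q^i) = c Q^i (Q^(r-i) - 1)`. -/
theorem cast_sub_eq_of_mul_eq {c m Q i r : ℕ} (hQ : 1 < Q) (hi : i < r) (hm : m ≤ c)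
    (h : m * (Q ^ r - 1) = c * (Q ^ i - 1)) :
    ((c - m : ℕ) : ℚ) = c * (Q : ℚ) ^ i * ((Q : ℚ) ^ (r - i) - 1) / ((Q : ℚ) ^ r - 1) := by
  have h1 : (1 : ℚ) < (Q : ℚ) ^ r := one_lt_pow₀ (by exact_mod_cast hQ) (by omega)
  have h2 : (m : ℚ) * ((Q : ℚ) ^ r - 1) = c * ((Q : ℚ) ^ i - 1) := by
    have := congrArg (Nat.cast (R := ℚ)) h
    push_cast [Nat.one_le_pow _ Q (by omega)] at this
    exact this
  have h3 : (Q : ℚ) ^ r = (Q : ℚ) ^ i * (Q : ℚ) ^ (r - i) := by rw [← pow_add]; congr 1; omega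
  rw [Nat.cast_sub hm, eq_div_iff (by linarith), sub_mul, h2, h3]
  ring

end Drinfeld

end

/-! ### The theorem -/

theorem mainTheorem5 {F K : Type*} [Field F] [Finite F] [Field K] [Algebra F K]
    [Drinfeld.IsGlobalFunctionField F K]
    (v : ValuationSubring K) [IsDiscreteValuationRing v] (r : ℕ)
    (Y Y' : Submodule (Drinfeld.coeffRing F v) (Fin r → K))
    (hY : Y.IsLattice K) (hY' : Y'.IsLattice K) (hYY' : Y ≤ Y')
    (p : Ideal (Drinfeld.coeffRing F v)) (hp : p.IsPrime) (hp0 : p ≠ ⊥)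
    (hcop : ¬ p ∣ Drinfeld.eulerPoincare (Drinfeld.coeffRing F v) (Y' ⧸ Y.submoduleOf Y'))
    (d : ℕ) (hd : d = Module.finrank F (Drinfeld.coeffRing F v ⧸ p))
    (i : ℕ) (hi : i < r) :
    ∃ e : ℕ,
      (e : ℚ) = Drinfeld.grassmannCard p r i * (Nat.card F : ℚ) ^ (d * i)
        * ((Nat.card F : ℚ) ^ (d * (r - i)) - 1) / ((Nat.card F : ℚ) ^ (d * r) - 1) ∧
      ∀ ω ∈ Drinfeld.Psi v r,
        Drinfeld.disc Y' Y ω ≠ 0 ∧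
        Drinfeld.heckeDisc p i Y' Y ω =
          (Drinfeld.disc (p • Y') (p • Y) ω / Drinfeld.disc Y' Y ω) ^ e
            * Drinfeld.disc Y' Y ω ^ Drinfeld.grassmannCard p r i ∧
        ∀ n : Drinfeld.coeffRing F v, p = Ideal.span {n} →
          Drinfeld.heckeDisc p i Y' Y ω =
            algebraMap (Drinfeld.KInf v) (Drinfeld.CInf v)
                (algebraMap K (Drinfeld.KInf v) (n : K))
              ^ ((1 - (Y.toAddSubgroup.relIndex Y'.toAddSubgroup : ℤ)) * (e : ℤ))
            * Drinfeld.disc Y' Y ω ^ Drinfeld.grassmannCard p r i := by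
  classical
  obtain ⟨a, hap, ha0⟩ := Submodule.exists_mem_ne_zero_of_ne_bot hp0
  -- A nonzero constant would be a unit in the proper ideal `p`. This nonconstant `a` makes `A`
  -- Dedekind with fraction field `K`.
  have haF : (a : K) ∉ Set.range (algebraMap F K) := by
    rintro ⟨c, hc⟩
    have hc' : algebraMap F (Drinfeld.coeffRing F v) c = a := Subtype.val_injective hc
    have hc0 : c ≠ 0 := by rintro rfl; exact ha0 (by rw [← hc', map_zero])
    exact hp.ne_top (Ideal.eq_top_of_isUnit_mem p hap (hc' ▸ (IsUnit.mk0 c hc0).map _))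
  have := Drinfeld.isFractionRing_coeffRing a.2 haF
  have := Drinfeld.isDedekindDomain_coeffRing a.2 haF
  have hpm := Drinfeld.isMaximal_of_isPrime hp hp0
  have := Drinfeld.finite_quotient_ideal hp0
  have hQ : Nat.card (Drinfeld.coeffRing F v ⧸ p) = Nat.card F ^ d :=
    hd ▸ Drinfeld.natCard_quotient_eq_pow
  obtain ⟨m, hmc, hmul, L, hL, hcard, hm⟩ := Drinfeld.exists_image_latticeOfSubspace_eq hY hpm hi
  rw [← Drinfeld.latticesOfType_eq_image hY hpm hp0] at hL
  obtain ⟨s, hs, hsY⟩ := Drinfeld.exists_notMem_forall_smul_mem hY hY'.fg hpm hcop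
  have hs0 : s ≠ 0 := by rintro rfl; exact hs p.zero_mem
  have hrel := Drinfeld.relIndex_ne_zero_of_smul_mem hY'.fg (Drinfeld.finite_quotient_span hs0) hsY
  have hrelp : (p • Y).toAddSubgroup.relIndex (p • Y').toAddSubgroup ≠ 0 := by
    refine Drinfeld.relIndex_ne_zero_of_smul_mem (hY'.fg.of_le Submodule.smul_le_right)
      (Drinfeld.finite_quotient_span hs0) fun x hx ↦ ?_
    refine Submodule.smul_induction_on hx (fun c hc z hz ↦ ?_) fun x z hx hz ↦ ?_
    · rw [smul_comm]
      exact Submodule.smul_mem_smul hc (hsY z hz)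
    · rw [smul_add]
      exact add_mem hx hz
  -- `e = c - m` counts the lattices `Z` that miss a given vector of `Y` outside `pY`; since `m ≤
  -- c`, the subtraction is not truncated.
  refine ⟨Drinfeld.grassmannCard p r i - m, ?_, fun ω hω ↦ ?_⟩
  · have := Drinfeld.cast_sub_eq_of_mul_eq (Drinfeld.one_lt_natCard_quotient hp.ne_top)
      hi hmc hmul
    rw [this, hQ, Nat.cast_pow, ← pow_mul, ← pow_mul, ← pow_mul]
  have h0 := Drinfeld.disc_ne_zero hω hYY' hY'.fg hrel
  have hmain : Drinfeld.heckeDisc p i Y' Y ω =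
      (Drinfeld.disc (p • Y') (p • Y) ω / Drinfeld.disc Y' Y ω) ^ (Drinfeld.grassmannCard p r i - m)
        * Drinfeld.disc Y' Y ω ^ Drinfeld.grassmannCard p r i := by
    rw [Drinfeld.heckeDisc_eq hω hYY' hY'.fg hpm hs hsY hrelp hL
      (hcard.trans (Nat.sub_add_cancel hmc).symm) hm]
    conv_rhs => rw [← Nat.sub_add_cancel hmc, Nat.add_sub_cancel, pow_add, ← mul_assoc, ← mul_pow,
      div_mul_cancel₀ _ h0]
  refine ⟨h0, hmain, ?_⟩
  rintro n rfl
  have hn : n ≠ 0 := by rintro rfl; simp at hp0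
  rw [hmain, Drinfeld.disc_span_singleton_smul hω hYY' hY'.fg hrel hn, mul_div_cancel_right₀ _ h0,
    zpow_mul, zpow_natCast]
  rfl
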